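/- Let $(X_k)_{k\ge1}$ be i.i.d. non-negative random variables with distribution $F$, $S_0=0$, $S_n=X_1+\dots+X_n$, and let $U(x)=\mathbb E\big[\#\{n\ge 0: S_n\le x\}\big]$ be the renewal function. Assume $R:=\sup\{r\ge 0:\int_0^\infty e^{rx}\,dF(x)<\infty\}>0$, and that the moment generating function $g(z)=\int_0^\infty e^{zx}\,dF(x)$, $\Re(z)<R$, has a meromorphic extension to the whole complex plane, still denoted by $g$ (with $1/(1-g)$ understood as $0$ at the poles of $g$ and as having modulus $\infty$ at the solutions of $g(z)=1$). Put $\mu=\mathbb E[X_1]$ and $\mu_2=\mathbb E[X_1^2]$. $F$ is called lattice if it is supported by $h\mathbb N=\{0,h,2h,\dots\}$ for some $h>0$; the largest such $h$ is its mesh. Let $v(x)=U(x)-\frac x\mu-\frac{\mu_2+\mu}{2\mu^2}$ if $F$ is lattice (with mesh normalised to $1$) and $v(x)=U(x)-\frac x\mu-\frac{\mu_2}{2\mu^2}$ if $F$ is non-lattice. **(Lattice case.)** Suppose that $F$ is lattice with mesh $1$ and that $$\liminf_{r\to+\infty}\ \sigma(r)=0,\qquad \sigma(r):=\sup_{-\pi\le\theta\le\pi}\left|\frac1{e^r(1-g(r+i\theta))}\right|.$$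 Let $Z$ be the set of solutions of $g(z)=1$ in $\{z\in\mathbb C: -\pi<\Im(z)\le\pi\}$, and $\rho_k(c)=\mathrm{Res}\Big(\frac{e^{-kz}}{(e^z-1)(1-g(z))};c\Big)$. Then $\{z\in Z:\Re(z)<r\}$ is finite for every real $r$, and for every integer $k\ge 0$, $U(k)<\infty$ and $v(k)$ is the sum of the residues at the non-zero solutions, in the following sense. - If $Z$ is finite, $v(k)=\sum_{z\in Z\setminus\{0\}}\rho_k(z)$. - There are real sequences $r_n\to+\infty$ with $\sigma(r_n)\to 0$, and for each of them $\displaystyle v(k)=\lim_{n\to\infty}\ \sum_{z\in Z\setminus\{0\},\ \Re(z)<r_n}\rho_k(z).$ - If $Z$ is infinite, enumerated without repetition as $z_0=0,z_1,z_2,\dots$ with $\Re(z_0)\le\Re(z_1)\le\cdots$, and if the series $\sum_{j\ge1}\rho_k(z_j)$ converges, then $v(k)=\sum_{j=1}^\infty\rho_k(z_j)$. **(Non-lattice case.)** Suppose that $F$ is non-lattice and that, for all $R_0>0$, $$\limsup_{\theta\to\pm\infty}\ \sup_{0\le r\le R_0}\left|\frac1{1-g(r+i\theta)}\right|<\infty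 .$$ Let $x>0$. Suppose that the equation $g(z)=1$ has infinitely many solutions in $\mathbb C$, enumerated without repetition as $z_0=0,z_1,z_2,\dots$, that all of them are real and simple ($g'(z_j)\ne0$), that $$\sum_{j=1}^\infty\left|\mathrm{Res}\Big(\frac{e^{-xz}}{z(1-g(z))};z_j\Big)\right|<\infty,\qquad\text{and that}\qquad \liminf_{r\to+\infty}\ \sup_{\theta\in\mathbb R}\left|\frac1{r(1-g(r+i\theta))}\right|=0 .$$ Then $U(x)<\infty$ and $$v(x)=\sum_{j=1}^\infty\mathrm{Res}\Big(\frac{e^{-xz}}{z(1-g(z))};z_j\Big),\qquad \mathrm{Res}\Big(\frac{e^{-xz}}{z(1-g(z))};z_j\Big)=-\frac{e^{-xz_j}}{z_j\,g'(z_j)}\quad(j\ge1).$$ -/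

import Mathlib

open MeasureTheory ProbabilityTheory Filter Topology
open scoped ENNReal

noncomputable section

namespace Renewal

/-- The arrival times `S_n`: the sum of the first `n` inter-arrival times
(the sequence of inter-arrival times is indexed from `0`). -/
def arrivalTime {Ω : Type*} (X : ℕ → Ω → ℝ) (n : ℕ) (ω : Ω) : ℝ :=
  ∑ i ∈ Finset.range n, X i ω

/-- The counting process `N(x) = ∑_{n ≥ 0} 1_{S_n ≤ x}`. -/
def count {Ω : Type*} (X : ℕ → Ω → ℝ) (x : ℝ) (ω : Ω) : ℝ≥0∞ :=
  ∑' n : ℕ, {ω' | arrivalTime X n ω' ≤ x}.indicator (fun _ => (1 : ℝ≥0∞)) ω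

/-- The expectation `E[N(x)]` in `[0, ∞]`. -/
def expectedCount {Ω : Type*} [MeasurableSpace Ω] (P : Measure Ω) (X : ℕ → Ω → ℝ) (x : ℝ) :
    ℝ≥0∞ :=
  ∫⁻ ω, count X x ω ∂P

/-- The renewal function `U(x) = E[N(x)]`. -/
def renewalFunction {Ω : Type*} [MeasurableSpace Ω] (P : Measure Ω) (X : ℕ → Ω → ℝ) (x : ℝ) : ℝ :=
  (expectedCount P X x).toReal

/-- The lattice `h ℕ = {0, h, 2h, …}`. -/
def multiples (h : ℝ) : Set ℝ := Set.range fun n : ℕ => (n : ℝ) * h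

/-- The distribution `F` is lattice: it is supported by `h ℕ` for some `h > 0`. -/
def IsLattice (F : Measure ℝ) : Prop := ∃ h : ℝ, 0 < h ∧ F (multiples h)ᶜ = 0

/-- `F` is lattice with mesh `h`: `h` is the largest positive number such that `F` is supported
by `h ℕ`. -/
def HasMesh (F : Measure ℝ) (h : ℝ) : Prop :=
  0 < h ∧ F (multiples h)ᶜ = 0 ∧ ∀ h' : ℝ, h < h' → F (multiples h')ᶜ ≠ 0

open Classical in
/-- The function `v`: with `μ` and `μ₂` the first two moments of the inter-arrival distribution,
`v(x) = U(x) - x/μ - (μ₂ + μ)/(2μ²)` in the lattice case (the mesh being normalised to `1`) and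
`v(x) = U(x) - x/μ - μ₂/(2μ²)` in the non-lattice case. -/
def remainder {Ω : Type*} [MeasurableSpace Ω] (P : Measure Ω) (X : ℕ → Ω → ℝ) (x : ℝ) : ℝ :=
  if IsLattice (P.map (X 0)) then
    renewalFunction P X x - x / (∫ ω, X 0 ω ∂P)
      - ((∫ ω, X 0 ω ^ 2 ∂P) + ∫ ω, X 0 ω ∂P) / (2 * (∫ ω, X 0 ω ∂P) ^ 2)
  else
    renewalFunction P X x - x / (∫ ω, X 0 ω ∂P)
      - (∫ ω, X 0 ω ^ 2 ∂P) / (2 * (∫ ω, X 0 ω ∂P) ^ 2)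

/-- `R = sup {r ≥ 0 ; E[exp (r Y)] < ∞}`, an element of `[0, ∞]`. -/
def expMomentBound {Ω : Type*} [MeasurableSpace Ω] (P : Measure Ω) (Y : Ω → ℝ) : EReal :=
  sSup ((fun r : ℝ => (r : EReal)) '' {r | 0 ≤ r ∧ Integrable (fun ω => Real.exp (r * Y ω)) P})

/-- `G` is the meromorphic extension to `ℂ` of the moment generating function
`z ↦ E[exp (z Y)]`, which is defined for `Re z < R`. The function `G` is in normal form: it is
analytic at every point that is not a pole, and it takes Mathlib's conventional value `0` at its
poles. In particular `G z = 1` holds only at genuine solutions. -/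
structure IsMeromorphicExtension {Ω : Type*} [MeasurableSpace Ω] (P : Measure Ω) (Y : Ω → ℝ)
    (G : ℂ → ℂ) : Prop where
  meromorphic : MeromorphicNFOn G Set.univ
  eq_mgf : ∀ z : ℂ, (z.re : EReal) < expMomentBound P Y → G z = complexMGF Y P z

open Classical in
/-- `|1 / (1 - G z)|` as a value in `[0, ∞]`: it is `0` at the poles of `G` and `∞` where
`G z = 1`. -/
def absRecip (G : ℂ → ℂ) (z : ℂ) : ℝ≥0∞ :=
  if AnalyticAt ℂ G z then ‖1 - G z‖ₑ⁻¹ else 0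

/-- The residue of `f` at `c`: the value of `(2πi)⁻¹ ∮ f` over all small circles around `c`. -/
def residue (f : ℂ → ℂ) (c : ℂ) : ℂ :=
  limUnder (𝓝[>] (0 : ℝ)) fun ρ => (2 * Real.pi * Complex.I)⁻¹ * ∮ z in C(c, ρ), f z

/-- The solutions of `G z = 1` in the fundamental domain `-π < Im z ≤ π`. -/
def latticeRoots (G : ℂ → ℂ) : Set ℂ :=
  {z | -Real.pi < z.im ∧ z.im ≤ Real.pi ∧ G z = 1}

/-- `Res (e^{-kz} / ((e^z - 1) (1 - G z)); c)`. -/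
def latticeResidue (G : ℂ → ℂ) (k : ℕ) (c : ℂ) : ℂ :=
  residue (fun z => Complex.exp (-(k * z)) / ((Complex.exp z - 1) * (1 - G z))) c

/-- `sup_{-π ≤ θ ≤ π} |1 / (e^r (1 - G (r + iθ)))|`. -/
def latticeSup (G : ℂ → ℂ) (r : ℝ) : ℝ≥0∞ :=
  ⨆ θ ∈ Set.Icc (-Real.pi) Real.pi, absRecip G (r + θ * Complex.I) / ENNReal.ofReal (Real.exp r)

/-- `Res (e^{-xz} / (z (1 - G z)); c)`. -/
def nonLatticeResidue (G : ℂ → ℂ) (x : ℝ) (c : ℂ) : ℂ :=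
  residue (fun z => Complex.exp (-(x * z)) / (z * (1 - G z))) c

/-- `sup_{θ ∈ ℝ} |1 / (r (1 - G (r + iθ)))|`, for `r > 0`. -/
def nonLatticeSup (G : ℂ → ℂ) (r : ℝ) : ℝ≥0∞ :=
  ⨆ θ : ℝ, absRecip G (r + θ * Complex.I) / ENNReal.ofReal r

/-- `limsup_{θ → ±∞} sup_{0 ≤ r ≤ R₀} |1 / (1 - G (r + iθ))| < ∞`. -/
def ConditionA (G : ℂ → ℂ) (R₀ : ℝ) : Prop :=
  limsup (fun θ : ℝ => ⨆ r ∈ Set.Icc 0 R₀, absRecip G (r + θ * Complex.I)) (atBot ⊔ atTop) < ⊤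

end Renewal

end

/-! Both cases come from one contour argument. Since X is non-negative and not almost surely 0,
|g(z)| ≤ g(Re z) < 1 for Re z < 0, so the geometric series ∑ g(z)^n = 1/(1 - g(z)) converges there,
and g^n is the transform of S_n. Writing an indicator of S_n ≤ x as an integral of exponentials over
a vertical line Re z = a < 0 and summing over n (`IsRenewalSequence.hasSum_integral`) turns U into a
contour integral of 1/(1 - g). Moving the line to Re z = r > 0 collects residues at the roots of g =
1, all of which have Re z ≥ 0. The one at 0 is a double pole and gives the elementary terms
subtracted in v (`residue_zero`); the poles of g become zeros of 1/(1 - g) and contribute nothing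
(`analyticAt_recipExt`).

Lattice case. The arrival times are integers, so the inversion is over one period of θ, with kernel
e^{-kz}/(1 - e^z). Periodicity of G under 2πi makes the two horizontal sides of the rectangle
cancel, and the right side is at most 2σ(r) after division by 2π. Hence v(k) differs from the sum
over the roots with Re z < r by at most 2σ(r) (`remainder_lattice`); all three forms of the
conclusion follow by taking r = r_n.

Non-lattice case. The kernel e^{-xz}/z is not absolutely integrable on a vertical line, so U is
first replaced by its mean over [x, x + δ], whose kernel decays like 1/z². Condition (A), extended
slightly to the left of the imaginary axis (`exists_strip_bound`), makes the horizontal sides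
vanish. The residue at a root z_j > 0 is damped by a factor `expMean δ z_j` in [0, 1], and the
remaining integral is at most `nonLatticeSup G r` / (xδ) (`norm_smoothedRenewal_sub_le`). The order
of limits matters: first r = r_n → ∞ with δ fixed, then δ → 0, by dominated convergence against the
absolutely convergent residue series and by right continuity of U.

The residue theorem for rectangles is obtained by subtracting the principal parts one at a time
(`rectIntegral_eq_sum_residue`). -/

namespace Renewal

/-! ### Integrals over the boundary of a rectangle -/

/-- The integral of `f` over the positively oriented boundary of `[a, b] × [c, d]`. -/
noncomputable def rectIntegral (f : ℂ → ℂ) (a b c d : ℝ) : ℂ :=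
  (∫ x in a..b, f (x + c * Complex.I)) - (∫ x in a..b, f (x + d * Complex.I))
    + Complex.I * (∫ y in c..d, f (b + y * Complex.I))
    - Complex.I * ∫ y in c..d, f (a + y * Complex.I)

/-- The closed rectangle `[a, b] × [c, d]`. -/
def closedRect (a b c d : ℝ) : Set ℂ := {z | z.re ∈ Set.Icc a b ∧ z.im ∈ Set.Icc c d}

/-- The open rectangle `(a, b) × (c, d)`. -/
def openRect (a b c d : ℝ) : Set ℂ := {z | z.re ∈ Set.Ioo a b ∧ z.im ∈ Set.Ioo c d}

theorem intervalIntegrable_horizontal {f : ℂ → ℂ} {a b c : ℝ} (hab : a ≤ b)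
    (hf : ∀ x ∈ Set.Icc a b, ContinuousAt f (x + c * Complex.I)) :
    IntervalIntegrable (fun x : ℝ => f (x + c * Complex.I)) volume a b := by
  refine ContinuousOn.intervalIntegrable fun x hx => ?_
  rw [Set.uIcc_of_le hab] at hx
  exact (ContinuousAt.comp (f := fun x : ℝ => (x : ℂ) + c * Complex.I) (hf x hx)
    (by fun_prop)).continuousWithinAt

theorem intervalIntegrable_vertical {f : ℂ → ℂ} {b c d : ℝ} (hcd : c ≤ d)
    (hf : ∀ y ∈ Set.Icc c d, ContinuousAt f (b + y * Complex.I)) :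
    IntervalIntegrable (fun y : ℝ => f (b + y * Complex.I)) volume c d := by
  refine ContinuousOn.intervalIntegrable fun y hy => ?_
  rw [Set.uIcc_of_le hcd] at hy
  exact (ContinuousAt.comp (f := fun y : ℝ => (b : ℂ) + y * Complex.I) (hf y hy)
    (by fun_prop)).continuousWithinAt

theorem integral_horizontal {F f : ℂ → ℂ} {a b c : ℝ} (hab : a ≤ b)
    (hF : ∀ x ∈ Set.Icc a b, HasDerivAt F (f (x + c * Complex.I)) (x + c * Complex.I))
    (hf : ∀ x ∈ Set.Icc a b, ContinuousAt f (x + c * Complex.I)) :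
    ∫ x in a..b, f (x + c * Complex.I) = F (b + c * Complex.I) - F (a + c * Complex.I) := by
  refine intervalIntegral.integral_eq_sub_of_hasDerivAt
    (f := fun x : ℝ => F (x + c * Complex.I)) (fun x hx => ?_)
    (intervalIntegrable_horizontal hab hf)
  rw [Set.uIcc_of_le hab] at hx
  have h : HasDerivAt (fun x : ℝ => (x : ℂ) + c * Complex.I) 1 x :=
    Complex.ofRealCLM.hasDerivAt.add_const _
  have := HasDerivAt.scomp x (hF x hx) h
  rwa [one_smul] at this

theorem integral_vertical {F f : ℂ → ℂ} {b c d : ℝ} (hcd : c ≤ d)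
    (hF : ∀ y ∈ Set.Icc c d, HasDerivAt F (f (b + y * Complex.I)) (b + y * Complex.I))
    (hf : ∀ y ∈ Set.Icc c d, ContinuousAt f (b + y * Complex.I)) :
    Complex.I * ∫ y in c..d, f (b + y * Complex.I)
      = F (b + d * Complex.I) - F (b + c * Complex.I) := by
  rw [← intervalIntegral.integral_const_mul]
  refine intervalIntegral.integral_eq_sub_of_hasDerivAt
    (f := fun y : ℝ => F (b + y * Complex.I)) (fun y hy => ?_)
    ((intervalIntegrable_vertical hcd hf).const_mul _)
  rw [Set.uIcc_of_le hcd] at hy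
  have h : HasDerivAt (fun y : ℝ => (b : ℂ) + y * Complex.I) Complex.I y := by
    simpa using ((Complex.ofRealCLM.hasDerivAt (x := y)).mul_const Complex.I).const_add (b : ℂ)
  exact HasDerivAt.scomp y (hF y hy) h

section

variable {f g : ℂ → ℂ} {a b c d : ℝ}

theorem rectIntegral_add (hab : a ≤ b) (hcd : c ≤ d)
    (hf : ∀ z ∈ closedRect a b c d \ openRect a b c d, ContinuousAt f z)
    (hg : ∀ z ∈ closedRect a b c d \ openRect a b c d, ContinuousAt g z) :
    rectIntegral (fun z => f z + g z) a b c d =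
      rectIntegral f a b c d + rectIntegral g a b c d := by
  have h1 : ∀ x ∈ Set.Icc a b, ((x : ℂ) + c * Complex.I) ∈ closedRect a b c d \ openRect a b c d :=
    fun x hx => ⟨by simpa [closedRect, hcd] using hx, by simp [openRect]⟩
  have h2 : ∀ x ∈ Set.Icc a b, ((x : ℂ) + d * Complex.I) ∈ closedRect a b c d \ openRect a b c d :=
    fun x hx => ⟨by simpa [closedRect, hcd] using hx, by simp [openRect]⟩
  have h3 : ∀ y ∈ Set.Icc c d, ((a : ℂ) + y * Complex.I) ∈ closedRect a b c d \ openRect a b c d :=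
    fun x hx => ⟨by simpa [closedRect, hab] using hx, by simp [openRect]⟩
  have h4 : ∀ y ∈ Set.Icc c d, ((b : ℂ) + y * Complex.I) ∈ closedRect a b c d \ openRect a b c d :=
    fun x hx => ⟨by simpa [closedRect, hab] using hx, by simp [openRect]⟩
  simp only [rectIntegral]
  rw [intervalIntegral.integral_add
      (intervalIntegrable_horizontal hab fun x hx => hf _ (h1 x hx))
      (intervalIntegrable_horizontal hab fun x hx => hg _ (h1 x hx)),
    intervalIntegral.integral_add
      (intervalIntegrable_horizontal hab fun x hx => hf _ (h2 x hx))
      (intervalIntegrable_horizontal hab fun x hx => hg _ (h2 x hx)),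
    intervalIntegral.integral_add
      (intervalIntegrable_vertical hcd fun x hx => hf _ (h3 x hx))
      (intervalIntegrable_vertical hcd fun x hx => hg _ (h3 x hx)),
    intervalIntegral.integral_add
      (intervalIntegrable_vertical hcd fun x hx => hf _ (h4 x hx))
      (intervalIntegrable_vertical hcd fun x hx => hg _ (h4 x hx))]
  ring

theorem rectIntegral_const_mul (k : ℂ) :
    rectIntegral (fun z => k * f z) a b c d = k * rectIntegral f a b c d := by
  simp only [rectIntegral, intervalIntegral.integral_const_mul]
  ring

theorem rectIntegral_congr (hab : a ≤ b) (hcd : c ≤ d)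
    (h : ∀ z ∈ closedRect a b c d \ openRect a b c d, f z = g z) :
    rectIntegral f a b c d = rectIntegral g a b c d := by
  simp only [rectIntegral]
  congr 1
  · congr 1
    · congr 1 <;> refine intervalIntegral.integral_congr fun x hx => h _ ?_ <;>
        rw [Set.uIcc_of_le hab] at hx <;>
        exact ⟨by simpa [closedRect, hcd] using hx, by simp [openRect]⟩
    · congr 1
      refine intervalIntegral.integral_congr fun x hx => h _ ?_
      rw [Set.uIcc_of_le hcd] at hx
      exact ⟨by simpa [closedRect, hab] using hx, by simp [openRect]⟩
  · congr 1
    refine intervalIntegral.integral_congr fun x hx => h _ ?_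
    rw [Set.uIcc_of_le hcd] at hx
    exact ⟨by simpa [closedRect, hab] using hx, by simp [openRect]⟩

theorem rectIntegral_eq_zero (hab : a ≤ b) (hcd : c ≤ d)
    (hf : ∀ z ∈ closedRect a b c d, DifferentiableAt ℂ f z) : rectIntegral f a b c d = 0 := by
  have := Complex.integral_boundary_rect_eq_zero_of_differentiableOn f (a + c * Complex.I)
    (b + d * Complex.I) fun z hz => (hf z ?_).differentiableWithinAt
  · simpa [rectIntegral] using this
  · simpa [Complex.mem_reProdIm, closedRect, Set.uIcc_of_le hab, Set.uIcc_of_le hcd] using hz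

/-- The four side integrals telescope over the corners. The primitive is needed on the boundary
only, so this covers (z - s)^n with n ≠ -1, singular inside. -/
theorem rectIntegral_deriv_eq_zero {F : ℂ → ℂ} (hab : a ≤ b) (hcd : c ≤ d)
    (hF : ∀ z ∈ closedRect a b c d \ openRect a b c d, HasDerivAt F (f z) z)
    (hf : ∀ z ∈ closedRect a b c d \ openRect a b c d, ContinuousAt f z) :
    rectIntegral f a b c d = 0 := by
  have h1 : ∀ x ∈ Set.Icc a b, ((x : ℂ) + c * Complex.I) ∈ closedRect a b c d \ openRect a b c d :=
    fun x hx => ⟨by simpa [closedRect, hcd] using hx, by simp [openRect]⟩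
  have h2 : ∀ x ∈ Set.Icc a b, ((x : ℂ) + d * Complex.I) ∈ closedRect a b c d \ openRect a b c d :=
    fun x hx => ⟨by simpa [closedRect, hcd] using hx, by simp [openRect]⟩
  have h3 : ∀ y ∈ Set.Icc c d, ((a : ℂ) + y * Complex.I) ∈ closedRect a b c d \ openRect a b c d :=
    fun x hx => ⟨by simpa [closedRect, hab] using hx, by simp [openRect]⟩
  have h4 : ∀ y ∈ Set.Icc c d, ((b : ℂ) + y * Complex.I) ∈ closedRect a b c d \ openRect a b c d :=
    fun x hx => ⟨by simpa [closedRect, hab] using hx, by simp [openRect]⟩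
  rw [rectIntegral,
    integral_horizontal hab (fun x hx => hF _ (h1 x hx)) (fun x hx => hf _ (h1 x hx)),
    integral_horizontal hab (fun x hx => hF _ (h2 x hx)) (fun x hx => hf _ (h2 x hx)),
    integral_vertical hcd (fun x hx => hF _ (h3 x hx)) (fun x hx => hf _ (h3 x hx)),
    integral_vertical hcd (fun x hx => hF _ (h4 x hx)) (fun x hx => hf _ (h4 x hx))]
  ring

theorem log_neg_of_im_neg {z : ℂ} (hz : z.im < 0) :
    Complex.log (-z) = Complex.log z + Real.pi * Complex.I := by
  rw [Complex.log, Complex.log, norm_neg, Complex.arg_neg_eq_arg_add_pi_of_im_neg hz]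
  push_cast; ring

theorem log_neg_of_im_pos {z : ℂ} (hz : 0 < z.im) :
    Complex.log (-z) = Complex.log z - Real.pi * Complex.I := by
  rw [Complex.log, Complex.log, norm_neg, Complex.arg_neg_eq_arg_sub_pi_of_im_pos hz]
  push_cast; ring

/-- The cut of log(z - s) runs left from s and meets only the left side. There log(-(z - s)) serves
as the primitive; the two branches differ by πi at the lower left corner and by -πi at the upper
left one, which adds up to 2πi. -/
theorem rectIntegral_inv_sub {s : ℂ} (hs : s ∈ openRect a b c d) :
    rectIntegral (fun z => (z - s)⁻¹) a b c d = 2 * Real.pi * Complex.I := by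
  obtain ⟨⟨ha, hb⟩, hc, hd⟩ := hs
  have hcont : ∀ z : ℂ, z - s ≠ 0 → ContinuousAt (fun z => (z - s)⁻¹) z := fun z hz =>
    (continuousAt_id.sub continuousAt_const).inv₀ hz
  have hlog : ∀ z : ℂ, z - s ∈ Complex.slitPlane →
      HasDerivAt (fun z => Complex.log (z - s)) ((z - s)⁻¹) z := fun z hz => by
    simpa using ((hasDerivAt_id z).sub_const s).clog hz
  have hlog' : ∀ z : ℂ, -(z - s) ∈ Complex.slitPlane →
      HasDerivAt (fun z => Complex.log (-(z - s))) ((z - s)⁻¹) z := fun z hz => by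
    have := (((hasDerivAt_id z).sub_const s).neg).clog hz
    have e : (-1 : ℂ) / -(z - s) = (z - s)⁻¹ := by rw [neg_div_neg_eq, one_div]
    rw [← e]
    exact this
  have e1 := integral_horizontal (f := fun z => (z - s)⁻¹) (c := c) (ha.trans hb).le
    (fun x _ => hlog (x + c * Complex.I) (Or.inr (by simp [sub_eq_zero, hc.ne])))
    (fun x _ => hcont _ (fun h => by simpa [sub_eq_zero, hc.ne] using congrArg Complex.im h))
  have e2 := integral_horizontal (f := fun z => (z - s)⁻¹) (c := d) (ha.trans hb).le
    (fun x _ => hlog (x + d * Complex.I) (Or.inr (by simp [sub_eq_zero, hd.ne'])))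
    (fun x _ => hcont _ (fun h => by simpa [sub_eq_zero, hd.ne'] using congrArg Complex.im h))
  have e3 := integral_vertical (f := fun z => (z - s)⁻¹) (b := b) (hc.trans hd).le
    (fun y _ => hlog (b + y * Complex.I) (Or.inl (by simpa using hb)))
    (fun y _ => hcont _ (fun h => by simpa [sub_eq_zero, hb.ne'] using congrArg Complex.re h))
  have e4 := integral_vertical (f := fun z => (z - s)⁻¹) (b := a) (hc.trans hd).le
    (fun y _ => hlog' (a + y * Complex.I) (Or.inl (by simpa using ha)))
    (fun y _ => hcont _ (fun h => by simpa [sub_eq_zero, ha.ne] using congrArg Complex.re h))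
  rw [log_neg_of_im_neg (z := a + c * Complex.I - s) (by simpa using hc),
    log_neg_of_im_pos (z := a + d * Complex.I - s) (by simpa using hd)] at e4
  rw [rectIntegral, e1, e2, e3, e4]
  ring

/-! ### Principal parts and residues -/

/-- `p` is holomorphic away from `s`, and its integrals over rectangles and circles around `s` are
`2πi r`. -/
structure IsPrincipalPart (p : ℂ → ℂ) (s r : ℂ) : Prop where
  differentiableAt : ∀ z, z ≠ s → DifferentiableAt ℂ p z
  rectIntegral_eq : ∀ a b c d : ℝ, s ∈ openRect a b c d →
    rectIntegral p a b c d = 2 * Real.pi * Complex.I * r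
  circleIntegral_eq : ∀ ρ : ℝ, 0 < ρ → (∮ z in C(s, ρ), p z) = 2 * Real.pi * Complex.I * r

theorem openRect_ne {z s : ℂ} (hs : s ∈ openRect a b c d)
    (hz : z ∈ closedRect a b c d \ openRect a b c d) : z ≠ s := by
  rintro rfl; exact hz.2 hs

theorem le_of_mem_openRect {s : ℂ} (hs : s ∈ openRect a b c d) : a ≤ b ∧ c ≤ d :=
  ⟨(hs.1.1.trans hs.1.2).le, (hs.2.1.trans hs.2.2).le⟩

theorem circleIntegrable_of_continuousAt {s : ℂ} {ρ : ℝ} (hρ : 0 < ρ)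
    (hf : ∀ z ∈ Metric.sphere s ρ, ContinuousAt f z) : CircleIntegrable f s ρ :=
  ContinuousOn.circleIntegrable hρ.le fun z hz => (hf z hz).continuousWithinAt

theorem IsPrincipalPart.add {p q : ℂ → ℂ} {s r t : ℂ} (hp : IsPrincipalPart p s r)
    (hq : IsPrincipalPart q s t) : IsPrincipalPart (fun z => p z + q z) s (r + t) where
  differentiableAt z hz := (hp.differentiableAt z hz).add (hq.differentiableAt z hz)
  rectIntegral_eq a b c d h := by
    rw [rectIntegral_add (le_of_mem_openRect h).1 (le_of_mem_openRect h).2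
      (fun z hz => (hp.differentiableAt z (openRect_ne h hz)).continuousAt)
      (fun z hz => (hq.differentiableAt z (openRect_ne h hz)).continuousAt),
      hp.rectIntegral_eq a b c d h, hq.rectIntegral_eq a b c d h]
    ring
  circleIntegral_eq ρ hρ := by
    rw [circleIntegral.integral_add, hp.circleIntegral_eq ρ hρ, hq.circleIntegral_eq ρ hρ]
    · ring
    · exact circleIntegrable_of_continuousAt hρ fun z hz =>
        (hp.differentiableAt z (ne_of_mem_of_not_mem hz (by simpa using hρ.ne))).continuousAt
    · exact circleIntegrable_of_continuousAt hρ fun z hz =>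
        (hq.differentiableAt z (ne_of_mem_of_not_mem hz (by simpa using hρ.ne))).continuousAt

theorem isPrincipalPart_inv (s k : ℂ) : IsPrincipalPart (fun z => k * (z - s)⁻¹) s k where
  differentiableAt z hz := by
    have : z - s ≠ 0 := sub_ne_zero.2 hz
    fun_prop (disch := assumption)
  rectIntegral_eq a b c d h := by
    rw [rectIntegral_const_mul, rectIntegral_inv_sub h, mul_comm]
  circleIntegral_eq ρ hρ := by
    have := circleIntegral.integral_const_mul k (fun z => (z - s)⁻¹) s ρ
    rw [circleIntegral.integral_sub_center_inv s hρ.ne'] at this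
    rw [this, mul_comm]

theorem isPrincipalPart_zpow (s k : ℂ) {n : ℤ} (hn : n ≠ -1) :
    IsPrincipalPart (fun z => k * (z - s) ^ n) s 0 where
  differentiableAt z hz := by
    have : z - s ≠ 0 := sub_ne_zero.2 hz
    exact ((differentiableAt_id.sub_const s).zpow (Or.inl this)).const_mul k
  rectIntegral_eq a b c d h := by
    rw [rectIntegral_const_mul, rectIntegral_deriv_eq_zero (le_of_mem_openRect h).1
      (le_of_mem_openRect h).2 (F := fun z => (z - s) ^ (n + 1) / (n + 1 : ℤ))]
    · simp
    · intro z hz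
      have h0 : z - s ≠ 0 := sub_ne_zero.2 (openRect_ne h hz)
      have hn' : ((n + 1 : ℤ) : ℂ) ≠ 0 := by exact_mod_cast fun h => hn (by omega)
      have := ((hasDerivAt_zpow (n + 1) (z - s) (Or.inl h0)).comp z
        ((hasDerivAt_id z).sub_const s)).div_const ((n + 1 : ℤ) : ℂ)
      rw [mul_one, add_sub_cancel_right, mul_div_cancel_left₀ _ hn'] at this
      exact this
    · intro z hz
      have h0 : z - s ≠ 0 := sub_ne_zero.2 (openRect_ne h hz)
      exact ((differentiableAt_id.sub_const s).zpow (Or.inl h0)).continuousAt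
  circleIntegral_eq ρ hρ := by
    have := circleIntegral.integral_const_mul k (fun z => (z - s) ^ n) s ρ
    rw [circleIntegral.integral_sub_zpow_of_ne hn] at this
    rw [this]; simp

theorem isPrincipalPart_zero (s : ℂ) : IsPrincipalPart (fun _ => 0) s 0 := by
  simpa using isPrincipalPart_zpow s 0 (n := 0) (by norm_num)

/-- Induction on the order of the pole: F = F(s) + (z - s) `dslope F s` splits off the leading term
F(s)(z - s)^(-n-1) and leaves a quotient of order n. Only the exponent -1 contributes to the
residue. -/
theorem exists_principalPart_of_analyticAt (n : ℕ) : ∀ {F : ℂ → ℂ} {s : ℂ}, AnalyticAt ℂ F s →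
    ∃ p h : ℂ → ℂ, ∃ r : ℂ, IsPrincipalPart p s r ∧ AnalyticAt ℂ h s ∧
      ∀ z, z ≠ s → (z - s) ^ (-(n : ℤ)) * F z = p z + h z := by
  induction n with
  | zero => exact fun {F s} hF => ⟨fun _ => 0, F, 0, isPrincipalPart_zero s, hF, by simp⟩
  | succ n ih =>
    intro F s hF
    obtain ⟨p, h, r, hp, hh, hph⟩ := ih (F := dslope F s) (s := s) (by
      obtain ⟨q, hq⟩ := hF
      exact ⟨_, hq.has_fpower_series_dslope_fslope⟩)
    obtain ⟨q, t, hq, hqt⟩ : ∃ q t, IsPrincipalPart q s t ∧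
        ∀ z, z ≠ s → q z = F s * (z - s) ^ (-((n + 1 : ℕ) : ℤ)) := by
      rcases Nat.eq_zero_or_pos n with rfl | hn
      · exact ⟨_, _, isPrincipalPart_inv s (F s), fun z _ => by simp⟩
      · exact ⟨_, _, isPrincipalPart_zpow s (F s) (n := -((n + 1 : ℕ) : ℤ)) (by omega),
          fun z _ => rfl⟩
    refine ⟨fun z => q z + p z, h, t + r, hq.add hp, hh, fun z hz => ?_⟩
    have hzs : z - s ≠ 0 := sub_ne_zero.2 hz
    have e : F z = F s + (z - s) * dslope F s z := by
      rw [dslope_of_ne _ hz, slope_def_field]; field_simp; ring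
    rw [add_assoc, ← hph z hz, hqt z hz, e, mul_add, mul_comm, add_right_inj, ← mul_assoc]
    congr 1
    rw [← zpow_add_one₀ hzs]
    congr 1
    push_cast; ring

theorem exists_principalPart {s : ℂ} (hf : MeromorphicAt f s) :
    ∃ p h : ℂ → ℂ, ∃ r : ℂ, IsPrincipalPart p s r ∧ AnalyticAt ℂ h s ∧
      ∀ z, z ≠ s → f z = p z + h z := by
  obtain ⟨n, hn⟩ := hf
  obtain ⟨p, h, r, hp, hh, e⟩ := exists_principalPart_of_analyticAt n hn
  refine ⟨p, h, r, hp, hh, fun z hz => ?_⟩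
  rw [← e z hz, smul_eq_mul, ← mul_assoc, zpow_neg, zpow_natCast, inv_mul_cancel₀, one_mul]
  exact pow_ne_zero _ (sub_ne_zero.2 hz)

theorem residue_eq_of_eventually {s r : ℂ}
    (h : ∀ᶠ ρ in 𝓝[>] (0 : ℝ), (∮ z in C(s, ρ), f z) = 2 * Real.pi * Complex.I * r) :
    residue f s = r := by
  refine Tendsto.limUnder_eq (tendsto_const_nhds.congr' ?_)
  filter_upwards [h] with ρ hρ
  rw [hρ, ← mul_assoc, inv_mul_cancel₀, one_mul]
  simp [Real.pi_ne_zero]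

theorem eventually_sphere {s : ℂ} {p : ℂ → Prop} (h : ∀ᶠ z in 𝓝[≠] s, p z) :
    ∀ᶠ ρ in 𝓝[>] (0 : ℝ), ∀ z ∈ Metric.sphere s ρ, p z := by
  rw [eventually_nhdsWithin_iff, Metric.eventually_nhds_iff] at h
  obtain ⟨ε, hε, h⟩ := h
  filter_upwards [Ioo_mem_nhdsGT hε] with ρ hρ z hz
  exact h (by rw [Metric.mem_sphere.1 hz]; exact hρ.2)
    (ne_of_mem_of_not_mem hz (by simpa using hρ.1.ne))

theorem eventually_closedBall {s : ℂ} {p : ℂ → Prop} (h : ∀ᶠ z in 𝓝 s, p z) :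
    ∀ᶠ ρ in 𝓝[>] (0 : ℝ), ∀ z ∈ Metric.closedBall s ρ, p z := by
  rw [Metric.eventually_nhds_iff] at h
  obtain ⟨ε, hε, h⟩ := h
  filter_upwards [Ioo_mem_nhdsGT hε] with ρ hρ z hz
  exact h ((Metric.mem_closedBall.1 hz).trans_lt hρ.2)

theorem circleIntegral_congr_sphere {s : ℂ} {ρ : ℝ} (hρ : 0 ≤ ρ)
    (h : ∀ z ∈ Metric.sphere s ρ, f z = g z) : (∮ z in C(s, ρ), f z) = ∮ z in C(s, ρ), g z :=
  circleIntegral.integral_congr hρ h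

theorem residue_congr {s : ℂ} (h : f =ᶠ[𝓝[≠] s] g) : residue f s = residue g s := by
  unfold residue limUnder
  congr 1
  refine Filter.map_congr ?_
  filter_upwards [eventually_sphere h, self_mem_nhdsWithin] with ρ hρ hρ0
  rw [circleIntegral_congr_sphere (le_of_lt hρ0) hρ]

theorem circleIntegral_eq_zero_of_analyticAt {s : ℂ} (hf : AnalyticAt ℂ f s) :
    ∀ᶠ ρ in 𝓝[>] (0 : ℝ), (∮ z in C(s, ρ), f z) = 0 := by
  filter_upwards [eventually_closedBall hf.eventually_analyticAt, self_mem_nhdsWithin] with ρ hρ hρ0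
  exact Complex.circleIntegral_eq_zero_of_differentiable_on_off_countable (le_of_lt hρ0)
    Set.countable_empty (fun z hz => (hρ z hz).continuousAt.continuousWithinAt)
    fun z hz => (hρ z (Metric.ball_subset_closedBall hz.1)).differentiableAt

theorem residue_add_analyticAt {s : ℂ} (hf : MeromorphicAt f s) (hg : AnalyticAt ℂ g s) :
    residue (fun z => f z + g z) s = residue f s := by
  unfold residue limUnder
  congr 1
  refine Filter.map_congr ?_
  filter_upwards [eventually_sphere hf.eventually_continuousAt, self_mem_nhdsWithin,
    circleIntegral_eq_zero_of_analyticAt hg,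
    eventually_closedBall hg.eventually_analyticAt] with ρ h1 hρ0 h2 h3
  rw [circleIntegral.integral_add (circleIntegrable_of_continuousAt hρ0 h1)
    (circleIntegrable_of_continuousAt hρ0 fun z hz =>
      (h3 z (Metric.sphere_subset_closedBall hz)).continuousAt), h2, add_zero]

theorem IsPrincipalPart.analyticAt {p : ℂ → ℂ} {s r z : ℂ} (hp : IsPrincipalPart p s r)
    (hz : z ≠ s) : AnalyticAt ℂ p z := by
  rw [Complex.analyticAt_iff_eventually_differentiableAt]
  filter_upwards [isOpen_compl_singleton.mem_nhds (Set.mem_compl_singleton_iff.2 hz)] with w hw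
  exact hp.differentiableAt w hw

theorem residue_eq_of_principalPart {p h : ℂ → ℂ} {s r : ℂ} (hp : IsPrincipalPart p s r)
    (hh : AnalyticAt ℂ h s) (hf : ∀ z, z ≠ s → f z = p z + h z) : residue f s = r := by
  refine residue_eq_of_eventually ?_
  filter_upwards [self_mem_nhdsWithin, circleIntegral_eq_zero_of_analyticAt hh,
    eventually_closedBall hh.eventually_analyticAt] with ρ hρ0 h2 h3
  have hne : ∀ z ∈ Metric.sphere s ρ, z ≠ s := fun z hz =>
    ne_of_mem_of_not_mem hz (by simpa using (ne_of_gt hρ0).symm)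
  rw [circleIntegral_congr_sphere (le_of_lt hρ0) fun z hz => hf z (hne z hz),
    circleIntegral.integral_add, h2, hp.circleIntegral_eq ρ hρ0, add_zero]
  · exact circleIntegrable_of_continuousAt hρ0 fun z hz =>
      (hp.differentiableAt z (hne z hz)).continuousAt
  · exact circleIntegrable_of_continuousAt hρ0 fun z hz =>
      (h3 z (Metric.sphere_subset_closedBall hz)).continuousAt

/-- **Residue theorem** for a rectangle. -/
theorem rectIntegral_eq_sum_residue (hab : a ≤ b) (hcd : c ≤ d) (S : Finset ℂ) : ∀ (f : ℂ → ℂ),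
    (∀ s ∈ S, s ∈ openRect a b c d) → (∀ s ∈ S, MeromorphicAt f s) →
    (∀ z ∈ closedRect a b c d, z ∉ S → DifferentiableAt ℂ f z) →
    rectIntegral f a b c d = 2 * Real.pi * Complex.I * ∑ s ∈ S, residue f s := by
  classical
  induction S using Finset.induction_on with
  | empty =>
    intro f _ _ hd
    rw [rectIntegral_eq_zero hab hcd fun z hz => hd z hz (by simp)]
    simp
  | insert s S hs ih =>
    intro f hS hm hd
    obtain ⟨p, h, r, hp, hh, e⟩ := exists_principalPart (hm s (by simp))
    have hsR := hS s (by simp)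
    -- Subtracting the principal part at s leaves a removable singularity, filled with the value h
    -- s. The new function has the same residues on S, so the induction hypothesis applies to it.
    have hf1 : ∀ z, z ≠ s → Function.update (fun z => f z + -p z) s (h s) z = f z + -p z :=
      fun z hz => Function.update_of_ne hz _ _
    have hev : ∀ z, z ≠ s →
        Function.update (fun z => f z + -p z) s (h s) =ᶠ[𝓝 z] fun z => f z + -p z := fun z hz => by
      filter_upwards [isOpen_compl_singleton.mem_nhds (Set.mem_compl_singleton_iff.2 hz)] with w hw
      exact hf1 w hw
    have hh1 : Function.update (fun z => f z + -p z) s (h s) =ᶠ[𝓝 s] h := by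
      refine Eventually.of_forall fun z => ?_
      by_cases hz : z = s
      · subst hz; simp
      · rw [hf1 z hz, e z hz]; ring
    have hne : ∀ t ∈ S, t ≠ s := fun t ht => ne_of_mem_of_not_mem ht hs
    have hpm : ∀ t, t ≠ s → AnalyticAt ℂ (fun z => -p z) t := fun t ht => (hp.analyticAt ht).neg
    have key := ih (Function.update (fun z => f z + -p z) s (h s))
      (fun t ht => hS t (Finset.mem_insert_of_mem ht))
      (fun t ht => ((hm t (Finset.mem_insert_of_mem ht)).add
        (hpm t (hne t ht)).meromorphicAt).congr
          ((hev t (hne t ht)).symm.filter_mono nhdsWithin_le_nhds))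
      (fun z hz hzS => by
        by_cases hzs : z = s
        · subst hzs
          exact hh1.differentiableAt_iff.2 hh.differentiableAt
        · exact (hev z hzs).differentiableAt_iff.2
            ((hd z hz (by simp [hzs, hzS])).add (hp.differentiableAt z hzs).neg))
    have hres : ∀ t ∈ S,
        residue (Function.update (fun z => f z + -p z) s (h s)) t = residue f t := by
      intro t ht
      rw [residue_congr ((hev t (hne t ht)).filter_mono nhdsWithin_le_nhds),
        residue_add_analyticAt (hm t (Finset.mem_insert_of_mem ht)) (hpm t (hne t ht))]
    rw [Finset.sum_congr rfl hres, rectIntegral_congr hab hcd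
      (fun z hz => hf1 z (openRect_ne hsR hz)), rectIntegral_add hab hcd] at key
    · have e2 : rectIntegral (fun z => -p z) a b c d = -rectIntegral p a b c d := by
        simpa using rectIntegral_const_mul (f := p) (a := a) (b := b) (c := c) (d := d) (-1)
      rw [e2, hp.rectIntegral_eq a b c d hsR] at key
      rw [Finset.sum_insert hs, residue_eq_of_principalPart hp hh e]
      linear_combination key
    · intro z hz
      refine (hd z hz.1 fun hzS => hz.2 (hS z hzS)).continuousAt
    · exact fun z hz => (hpm z (openRect_ne hsR hz)).continuousAt

theorem residue_of_simple_pole {F : ℂ → ℂ} {s : ℂ} (hF : AnalyticAt ℂ F s)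
    (h : ∀ᶠ z in 𝓝[≠] s, f z = F z / (z - s)) : residue f s = F s := by
  refine residue_eq_of_eventually ?_
  filter_upwards [eventually_sphere h, self_mem_nhdsWithin,
    eventually_closedBall hF.eventually_analyticAt] with ρ h1 hρ0 h2
  have hρ0' : (0 : ℝ) < ρ := hρ0
  rw [circleIntegral_congr_sphere hρ0'.le fun z hz => (h1 z hz).trans (div_eq_inv_mul _ _)]
  exact DifferentiableOn.circleIntegral_sub_inv_smul (f := F)
    (fun z hz => (h2 z hz).differentiableAt.differentiableWithinAt) (Metric.mem_ball_self hρ0')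

theorem residue_of_double_pole {F : ℂ → ℂ} {s : ℂ} (hF : AnalyticAt ℂ F s)
    (h : ∀ᶠ z in 𝓝[≠] s, f z = F z / (z - s) ^ 2) : residue f s = deriv F s := by
  refine residue_eq_of_eventually ?_
  filter_upwards [eventually_sphere h, self_mem_nhdsWithin,
    eventually_closedBall hF.eventually_analyticAt] with ρ h1 hρ0 h2
  have hρ0' : (0 : ℝ) < ρ := hρ0
  rw [circleIntegral_congr_sphere hρ0'.le fun z hz => (h1 z hz).trans (div_eq_inv_mul _ _),
    ← Complex.two_pi_I_inv_smul_circleIntegral_sub_sq_inv_smul_of_differentiable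
      (isOpen_analyticAt ℂ F) h2 (fun z hz => hz.differentiableAt.differentiableWithinAt)
      (Metric.mem_ball_self hρ0'), smul_eq_mul, mul_inv_cancel_left₀ (by simp [Real.pi_ne_zero])]
  rfl

end

/-! ### The meromorphic function `1 / (1 - G)` -/

open Classical in
/-- The function `1 / (1 - G)`, with value `0` at the poles of `G`. -/
noncomputable def recipExt (G : ℂ → ℂ) (z : ℂ) : ℂ := if AnalyticAt ℂ G z then (1 - G z)⁻¹ else 0

section

variable {G : ℂ → ℂ} {z : ℂ}

theorem recipExt_eventuallyEq (hG : MeromorphicAt G z) :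
    recipExt G =ᶠ[𝓝[≠] z] fun w => (1 - G w)⁻¹ := by
  filter_upwards [hG.eventually_analyticAt] with w hw
  simp [recipExt, hw]

theorem meromorphicAt_recipExt (hG : MeromorphicAt G z) : MeromorphicAt (recipExt G) z :=
  (((MeromorphicAt.const 1 z).sub hG).inv).congr (recipExt_eventuallyEq hG).symm

theorem recipExt_eventuallyEq_nhds (hG : AnalyticAt ℂ G z) :
    recipExt G =ᶠ[𝓝 z] fun w => (1 - G w)⁻¹ := by
  filter_upwards [hG.eventually_analyticAt] with w hw
  simp [recipExt, hw]

/-- In normal form a non-zero value forces order zero; the conventional value at a pole is 0 and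
cannot pass for a root. -/
theorem analyticAt_of_eq_one (hG : MeromorphicNFAt G z) (h : G z = 1) : AnalyticAt ℂ G z :=
  hG.meromorphicOrderAt_nonneg_iff_analyticAt.1
    (hG.meromorphicOrderAt_eq_zero_iff.2 (by simp [h])).ge

/-- At a pole of G, 1/(1 - G) tends to 0, so its order is positive and the prescribed value 0 is the
one that makes it analytic. -/
theorem analyticAt_recipExt (hG : MeromorphicNFAt G z) (h : G z ≠ 1) :
    AnalyticAt ℂ (recipExt G) z := by
  by_cases ha : AnalyticAt ℂ G z
  · exact (analyticAt_congr (recipExt_eventuallyEq_nhds ha)).2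
      ((analyticAt_const.sub ha).inv (sub_ne_zero.2 h.symm))
  · have hneg : meromorphicOrderAt G z < 0 := by
      rw [← not_le, hG.meromorphicOrderAt_nonneg_iff_analyticAt]; exact ha
    refine AnalyticAt.of_meromorphicOrderAt_pos ?_ (by simp [recipExt, ha])
    rw [meromorphicOrderAt_congr (recipExt_eventuallyEq hG.meromorphicAt)]
    have h1 : MeromorphicAt (fun w => 1 - G w) z := (MeromorphicAt.const 1 z).sub hG.meromorphicAt
    change 0 < meromorphicOrderAt (fun w => 1 - G w)⁻¹ z
    rw [← tendsto_zero_iff_meromorphicOrderAt_pos h1.inv]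
    have h2 := tendsto_cobounded_of_meromorphicOrderAt_neg hneg
    refine tendsto_inv₀_cobounded.comp ?_
    have h3 := (tendsto_const_sub_cobounded (1 : ℂ)).comp h2
    exact h3

theorem differentiableAt_recipExt (hG : MeromorphicNFAt G z) (h : G z ≠ 1) :
    DifferentiableAt ℂ (recipExt G) z := (analyticAt_recipExt hG h).differentiableAt

theorem enorm_recipExt (h : G z ≠ 1) : ‖recipExt G z‖ₑ = absRecip G z := by
  unfold recipExt absRecip
  split_ifs with ha
  · exact enorm_inv (sub_ne_zero.2 h.symm)
  · simp

theorem absRecip_eq_top (hG : MeromorphicNFAt G z) (h : G z = 1) : absRecip G z = ⊤ := by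
  simp [absRecip, analyticAt_of_eq_one hG h, h]

theorem norm_recipExt_le {C : ℝ≥0∞} (hC : C ≠ ⊤) (hG : MeromorphicNFAt G z)
    (h : absRecip G z ≤ C) : G z ≠ 1 ∧ ‖recipExt G z‖ ≤ C.toReal := by
  have h1 : G z ≠ 1 := fun h1 => by
    rw [absRecip_eq_top hG h1, top_le_iff] at h
    exact hC h
  refine ⟨h1, ?_⟩
  rw [← enorm_recipExt h1] at h
  rw [← toReal_enorm]
  exact ENNReal.toReal_mono hC h

/-- Identity theorem: finiteness of the order of G - 1 spreads from one point to the connected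
plane. It makes the roots discrete. -/
theorem eventually_ne_one (hG : MeromorphicNFOn G Set.univ) {w : ℂ}
    (hw : ∀ᶠ u in 𝓝[≠] w, G u ≠ 1) (z : ℂ) : ∀ᶠ u in 𝓝[≠] z, G u ≠ 1 := by
  have hm : MeromorphicOn (fun u => G u - 1) Set.univ :=
    fun u hu => (hG hu).meromorphicAt.sub (MeromorphicAt.const 1 u)
  have h1 : meromorphicOrderAt (fun u => G u - 1) w ≠ ⊤ :=
    (meromorphicOrderAt_ne_top_iff_eventually_ne_zero (hm w trivial)).2
      (hw.mono fun u hu => sub_ne_zero.2 hu)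
  have h2 := hm.meromorphicOrderAt_ne_top_of_isPreconnected isPreconnected_univ
    (Set.mem_univ w) (Set.mem_univ z) h1
  exact ((meromorphicOrderAt_ne_top_iff_eventually_ne_zero (hm z trivial)).1 h2).mono
    fun u hu => sub_ne_zero.1 hu

theorem finite_roots (hG : MeromorphicNFOn G Set.univ) {w : ℂ}
    (hw : ∀ᶠ u in 𝓝[≠] w, G u ≠ 1) {K : Set ℂ} (hK : IsCompact K) :
    {z ∈ K | G z = 1}.Finite := by
  by_contra hinf
  obtain ⟨x, -, hx⟩ := Set.Infinite.exists_accPt_of_subset_isCompact hinf hK (fun z hz => hz.1)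
  rw [accPt_iff_frequently_nhdsNE] at hx
  exact (hx.mono fun z hz => hz.2) (eventually_ne_one hG hw x)

/-- Identity theorem for meromorphic functions; the normal form upgrades agreement on punctured
neighbourhoods to equality everywhere, poles included. -/
theorem eq_of_eventuallyEq {F : ℂ → ℂ} (hF : MeromorphicNFOn F Set.univ)
    (hG : MeromorphicNFOn G Set.univ) (h : F =ᶠ[𝓝 z] G) : F = G := by
  have hm : MeromorphicOn (F - G) Set.univ :=
    fun u hu => (hF hu).meromorphicAt.sub (hG hu).meromorphicAt
  have h1 : meromorphicOrderAt (F - G) z = ⊤ := by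
    rw [meromorphicOrderAt_eq_top_iff]
    exact (h.filter_mono nhdsWithin_le_nhds).mono fun u hu => sub_eq_zero.2 hu
  funext u
  have h2 : meromorphicOrderAt (F - G) u = ⊤ := by
    by_contra h2
    exact hm.meromorphicOrderAt_ne_top_of_isPreconnected isPreconnected_univ
      (Set.mem_univ u) (Set.mem_univ z) h2 h1
  rw [meromorphicOrderAt_eq_top_iff] at h2
  exact (((hF (Set.mem_univ u)).eventuallyEq_nhdsNE_iff_eventuallyEq_nhds
    (hG (Set.mem_univ u))).1 (h2.mono fun w hw => sub_eq_zero.1 hw)).eq_of_nhds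

end

/-- A holomorphic function factors as `f z = f c + (z - c) A z`, with `A c = f' c` and
`A' c = f'' c / 2`. -/
theorem exists_eq_add_mul {f : ℂ → ℂ} {c : ℂ} (hf : AnalyticAt ℂ f c) :
    ∃ A : ℂ → ℂ, AnalyticAt ℂ A c ∧ (∀ z, f z = f c + (z - c) * A z) ∧ A c = deriv f c ∧
      deriv A c = deriv (deriv f) c / 2 := by
  have hA : AnalyticAt ℂ (dslope f c) c := by
    obtain ⟨q, hq⟩ := hf
    exact ⟨_, hq.has_fpower_series_dslope_fslope⟩
  have e : ∀ z, f z = f c + (z - c) * dslope f c z := fun z => by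
    have := sub_smul_dslope f c z
    rw [smul_eq_mul] at this
    rw [this]; ring
  refine ⟨dslope f c, hA, e, dslope_same f c, ?_⟩
  have h1 : deriv f =ᶠ[𝓝 c] fun z => dslope f c z + (z - c) * deriv (dslope f c) z := by
    filter_upwards [hA.eventually_analyticAt] with z hz
    have := (((hasDerivAt_id z).sub_const c).mul hz.differentiableAt.hasDerivAt).const_add (f c)
    have h2 : HasDerivAt f (1 * dslope f c z + (z - c) * deriv (dslope f c) z) z :=
      this.congr_of_eventuallyEq (Eventually.of_forall e)
    rw [h2.deriv, one_mul]
  rw [h1.deriv_eq]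
  have h2 := hA.differentiableAt.hasDerivAt.add
    (((hasDerivAt_id c).sub_const c).mul hA.deriv.differentiableAt.hasDerivAt)
  have h3 : deriv (fun z => dslope f c z + (z - c) * deriv (dslope f c) z) c = _ := h2.deriv
  rw [h3]; simp

/-! ### The moment generating function of a non-negative random variable -/

section

variable {Ω : Type*} [MeasurableSpace Ω] {P : Measure Ω} {Y : Ω → ℝ}
  {G : ℂ → ℂ}

/-- For Y ≥ 0, e^{tY} ≤ e^{sY} whenever t ≤ s, so integrability at some s > r gives it on the whole
half-line below s. -/
theorem mem_interior_integrableExpSet (hY : AEMeasurable Y P) (h0 : ∀ᵐ ω ∂P, 0 ≤ Y ω) {r : ℝ}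
    (hr : (r : EReal) < expMomentBound P Y) : r ∈ interior (integrableExpSet Y P) := by
  obtain ⟨_, ⟨s, ⟨-, hs⟩, rfl⟩, hrs⟩ := lt_sSup_iff.1 hr
  refine mem_interior.2 ⟨Set.Iio s, fun t ht => ?_, isOpen_Iio, EReal.coe_lt_coe_iff.1 hrs⟩
  refine Integrable.mono' hs ((Real.measurable_exp.comp_aemeasurable
    (hY.const_mul t)).aestronglyMeasurable) ?_
  filter_upwards [h0] with ω hω
  rw [Real.norm_eq_abs, Real.abs_exp]
  exact Real.exp_le_exp.2 (mul_le_mul_of_nonneg_right (le_of_lt ht) hω)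

theorem norm_cexp_mul_le_one {z : ℂ} (hz : z.re ≤ 0) {y : ℝ} (hy : 0 ≤ y) :
    ‖Complex.exp (z * y)‖ ≤ 1 := by
  rw [Complex.norm_exp, Complex.re_mul_ofReal, Real.exp_le_one_iff]
  exact mul_nonpos_of_nonpos_of_nonneg hz hy

/-- Equality would force e^{aY} = 1, that is Y = 0, almost surely. The strict inequality is what
makes the geometric series converge. -/
theorem mgf_neg_lt_one [IsProbabilityMeasure P] (hY : AEMeasurable Y P)
    (h0 : ∀ᵐ ω ∂P, 0 ≤ Y ω) (hne : ¬ Y =ᵐ[P] 0)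
    {a : ℝ} (ha : a < 0) : mgf Y P a < 1 := by
  have hle : ∀ᵐ ω ∂P, Real.exp (a * Y ω) ≤ 1 := h0.mono fun ω hω =>
    Real.exp_le_one_iff.2 (mul_nonpos_of_nonpos_of_nonneg ha.le hω)
  have hint : Integrable (fun ω => Real.exp (a * Y ω)) P := by
    refine Integrable.of_bound (Real.measurable_exp.comp_aemeasurable
      (hY.const_mul a)).aestronglyMeasurable 1 (hle.mono fun ω hω => ?_)
    rwa [Real.norm_eq_abs, Real.abs_exp]
  have h1 : 0 ≤ ∫ ω, (1 - Real.exp (a * Y ω)) ∂P :=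
    integral_nonneg_of_ae (hle.mono fun ω hω => sub_nonneg.2 hω)
  have h2 : ∫ ω, (1 - Real.exp (a * Y ω)) ∂P = 1 - mgf Y P a := by
    rw [integral_sub (integrable_const _) hint]; simp [mgf]
  rcases h1.lt_or_eq with h | h
  · linarith
  · refine absurd ?_ hne
    have h3 := (integral_eq_zero_iff_of_nonneg_ae (hle.mono fun ω hω => sub_nonneg.2 hω)
      ((integrable_const _).sub hint)).1 h.symm
    filter_upwards [h3] with ω hω
    have : Real.exp (a * Y ω) = 1 := (sub_eq_zero.1 hω).symm
    rw [Real.exp_eq_one_iff] at this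
    simpa [ha.ne] using this

theorem integral_pos_of_not_ae_zero (h0 : ∀ᵐ ω ∂P, 0 ≤ Y ω) (hint : Integrable Y P)
    (hne : ¬ Y =ᵐ[P] 0) : 0 < ∫ ω, Y ω ∂P :=
  (integral_nonneg_of_ae h0).lt_of_ne fun h =>
    hne ((integral_eq_zero_iff_of_nonneg_ae h0 hint).1 h.symm)

namespace IsMeromorphicExtension

theorem eventuallyEq (hG : IsMeromorphicExtension P Y G) {z : ℂ}
    (hz : (z.re : EReal) < expMomentBound P Y) : G =ᶠ[𝓝 z] complexMGF Y P := by
  have : IsOpen {w : ℂ | (w.re : EReal) < expMomentBound P Y} :=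
    isOpen_Iio.preimage (continuous_coe_real_ereal.comp Complex.continuous_re)
  filter_upwards [this.mem_nhds hz] with w hw
  exact hG.eq_mgf w hw

theorem lt_of_re_nonpos (hR : 0 < expMomentBound P Y) {r : ℝ} (hr : r ≤ 0) :
    (r : EReal) < expMomentBound P Y :=
  lt_of_le_of_lt (by exact_mod_cast hr) hR

theorem eq_of_re_nonpos (hG : IsMeromorphicExtension P Y G) (hR : 0 < expMomentBound P Y) {z : ℂ}
    (hz : z.re ≤ 0) : G z = complexMGF Y P z := hG.eq_mgf z (lt_of_re_nonpos hR hz)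

theorem analyticAt (hY : AEMeasurable Y P) (h0 : ∀ᵐ ω ∂P, 0 ≤ Y ω)
    (hG : IsMeromorphicExtension P Y G) {z : ℂ}
    (hz : (z.re : EReal) < expMomentBound P Y) : AnalyticAt ℂ G z :=
  (analyticAt_congr (hG.eventuallyEq hz)).2
    (analyticAt_complexMGF (mem_interior_integrableExpSet hY h0 hz))

theorem apply_zero [IsProbabilityMeasure P] (hG : IsMeromorphicExtension P Y G)
    (hR : 0 < expMomentBound P Y) :
    G 0 = 1 := by
  rw [hG.eq_of_re_nonpos hR (by simp)]; simp [complexMGF]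

theorem deriv_zero (hY : AEMeasurable Y P) (h0 : ∀ᵐ ω ∂P, 0 ≤ Y ω)
    (hG : IsMeromorphicExtension P Y G) (hR : 0 < expMomentBound P Y) :
    deriv G 0 = (∫ ω, Y ω ∂P : ℝ) := by
  rw [(hG.eventuallyEq (z := 0) (by simpa using hR)).deriv_eq, (hasDerivAt_complexMGF
    (mem_interior_integrableExpSet hY h0 (by simpa using hR))).deriv, ← integral_complex_ofReal]
  simp

theorem deriv_deriv_zero (hY : AEMeasurable Y P) (h0 : ∀ᵐ ω ∂P, 0 ≤ Y ω)
    (hG : IsMeromorphicExtension P Y G) (hR : 0 < expMomentBound P Y) :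
    deriv (deriv G) 0 = (∫ ω, Y ω ^ 2 ∂P : ℝ) := by
  rw [(hG.eventuallyEq (z := 0) (by simpa using hR)).deriv.deriv_eq]
  have := iteratedDeriv_complexMGF (X := Y) (μ := P) (z := 0)
    (mem_interior_integrableExpSet hY h0 (by simpa using hR)) 2
  rw [iteratedDeriv_succ, iteratedDeriv_one] at this
  rw [this, ← integral_complex_ofReal]
  simp

theorem norm_lt_one [IsProbabilityMeasure P] (hY : AEMeasurable Y P)
    (h0 : ∀ᵐ ω ∂P, 0 ≤ Y ω) (hne : ¬ Y =ᵐ[P] 0)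
    (hG : IsMeromorphicExtension P Y G) (hR : 0 < expMomentBound P Y) {z : ℂ} (hz : z.re < 0) :
    ‖G z‖ < 1 := by
  rw [hG.eq_of_re_nonpos hR hz.le]
  exact norm_complexMGF_le_mgf.trans_lt (mgf_neg_lt_one hY h0 hne hz)

theorem re_nonneg_of_eq_one [IsProbabilityMeasure P] (hY : AEMeasurable Y P)
    (h0 : ∀ᵐ ω ∂P, 0 ≤ Y ω) (hne : ¬ Y =ᵐ[P] 0)
    (hG : IsMeromorphicExtension P Y G) (hR : 0 < expMomentBound P Y) {z : ℂ} (hz : G z = 1) :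
    0 ≤ z.re := by
  by_contra! h
  have := hG.norm_lt_one hY h0 hne hR h
  simp [hz] at this

theorem finite_roots [IsProbabilityMeasure P] (hY : AEMeasurable Y P)
    (h0 : ∀ᵐ ω ∂P, 0 ≤ Y ω) (hne : ¬ Y =ᵐ[P] 0)
    (hG : IsMeromorphicExtension P Y G) (hR : 0 < expMomentBound P Y) {K : Set ℂ}
    (hK : IsCompact K) : {z ∈ K | G z = 1}.Finite := by
  -- The base point -1 lies in the half-plane Re z < 0, where |G| < 1, so G is not identically 1.
  refine Renewal.finite_roots hG.meromorphic (w := -1) (eventually_nhdsWithin_of_eventually_nhds ?_)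
    hK
  filter_upwards [(isOpen_Iio.preimage Complex.continuous_re).mem_nhds
    (show (-1 : ℂ) ∈ Complex.re ⁻¹' Set.Iio 0 by simp)] with w hw h
  exact absurd (hG.re_nonneg_of_eq_one hY h0 hne hR h) (not_le.2 hw)

theorem integrable (hY : AEMeasurable Y P) (h0 : ∀ᵐ ω ∂P, 0 ≤ Y ω)
    (hR : 0 < expMomentBound P Y) : Integrable Y P := by
  have := integrable_pow_of_mem_interior_integrableExpSet
    (mem_interior_integrableExpSet hY h0 (r := 0) (by simpa using hR)) 1
  simpa using this

/-- Factor out e^{iθY}, of modulus 1, and use 0 ≤ 1 - e^{sY} ≤ -sY. The bound is uniform in θ, which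
lets a lower bound for |1 - G| on the imaginary axis survive a small shift to the left. -/
theorem norm_sub_le [IsProbabilityMeasure P] (hY : AEMeasurable Y P) (h0 : ∀ᵐ ω ∂P, 0 ≤ Y ω)
    (hG : IsMeromorphicExtension P Y G) (hR : 0 < expMomentBound P Y) {s θ : ℝ} (hs : s ≤ 0) :
    ‖G (s + θ * Complex.I) - G (θ * Complex.I)‖ ≤ -s * ∫ ω, Y ω ∂P := by
  have hm : ∀ z : ℂ, AEStronglyMeasurable (fun ω => Complex.exp (z * Y ω)) P := fun z =>
    (Complex.measurable_exp.comp_aemeasurable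
      ((Complex.measurable_ofReal.comp_aemeasurable hY).const_mul z)).aestronglyMeasurable
  have hi : ∀ z : ℂ, z.re ≤ 0 → Integrable (fun ω => Complex.exp (z * Y ω)) P := fun z hz =>
    Integrable.of_bound (hm z) 1 (h0.mono fun ω hω => norm_cexp_mul_le_one hz hω)
  rw [hG.eq_of_re_nonpos hR (by simpa using hs), hG.eq_of_re_nonpos hR (by simp), complexMGF,
    complexMGF, ← integral_sub (hi _ (by simpa using hs)) (hi _ (by simp)), ← integral_const_mul]
  refine norm_integral_le_of_norm_le ((integrable hY h0 hR).const_mul _) (h0.mono fun ω hω => ?_)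
  have e : Complex.exp ((s + θ * Complex.I) * Y ω) - Complex.exp (θ * Complex.I * Y ω)
      = Complex.exp ((θ * Y ω : ℝ) * Complex.I) * ((Real.exp (s * Y ω) - 1 : ℝ) : ℂ) := by
    push_cast
    rw [mul_sub, ← Complex.exp_add]
    ring_nf
  rw [e, norm_mul, Complex.norm_exp_ofReal_mul_I, one_mul, Complex.norm_real, Real.norm_eq_abs,
    abs_sub_comm, abs_of_nonneg (sub_nonneg.2 (Real.exp_le_one_iff.2
      (mul_nonpos_of_nonpos_of_nonneg hs hω)))]
  linarith [Real.add_one_le_exp (s * Y ω)]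

end IsMeromorphicExtension

end

/-! ### Arrival times -/

/-- `X` is a sequence of i.i.d. non-negative random variables, not almost surely zero. -/
structure IsRenewalSequence {Ω : Type*} [MeasurableSpace Ω] (P : Measure Ω) (X : ℕ → Ω → ℝ) :
    Prop where
  meas : ∀ i, AEMeasurable (X i) P
  nonneg : ∀ i, ∀ᵐ ω ∂P, 0 ≤ X i ω
  indep : iIndepFun X P
  ident : ∀ i, IdentDistrib (X i) (X 0) P P
  ne_zero : ¬ X 0 =ᵐ[P] 0

namespace IsRenewalSequence

variable {Ω : Type*} [MeasurableSpace Ω] {P : Measure Ω} {X : ℕ → Ω → ℝ}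

theorem isProbabilityMeasure (hX : IsRenewalSequence P X) : IsProbabilityMeasure P :=
  hX.indep.isProbabilityMeasure

theorem aemeasurable_arrivalTime (hX : IsRenewalSequence P X) (n : ℕ) :
    AEMeasurable (arrivalTime X n) P :=
  Finset.aemeasurable_fun_sum _ fun i _ => hX.meas i

theorem arrivalTime_nonneg (hX : IsRenewalSequence P X) (n : ℕ) :
    ∀ᵐ ω ∂P, 0 ≤ arrivalTime X n ω := by
  filter_upwards [ae_all_iff.2 hX.nonneg] with ω hω
  exact Finset.sum_nonneg fun i _ => hω i

theorem mgf_arrivalTime (hX : IsRenewalSequence P X) (n : ℕ) (t : ℝ) :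
    mgf (arrivalTime X n) P t = mgf (X 0) P t ^ n := by
  have e : arrivalTime X n = ∑ i ∈ Finset.range n, X i := by
    ext ω; simp [arrivalTime]
  rw [e, hX.indep.mgf_sum₀ hX.meas, Finset.prod_congr rfl fun i _ =>
    mgf_congr_of_identDistrib (X i) (X 0) (hX.ident i) t]
  simp

theorem complexMGF_arrivalTime (hX : IsRenewalSequence P X) (n : ℕ) (z : ℂ) :
    complexMGF (arrivalTime X n) P z = complexMGF (X 0) P z ^ n := by
  have hi : iIndepFun (fun i : Fin n => X i) P := hX.indep.precomp Fin.val_injective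
  have h := iIndepFun.integral_fun_prod_comp (𝕜 := ℂ) (X := fun i : Fin n => X i)
    (f := fun _ x => Complex.exp (z * x)) hi (fun i => hX.meas i) (fun i => by fun_prop)
  have h2 : ∀ i : Fin n, ∫ ω, Complex.exp (z * X i ω) ∂P = complexMGF (X 0) P z := fun i => by
    have := complexMGF_congr_identDistrib (hX.ident i)
    rw [← this]; rfl
  simp only [h2, Finset.prod_const, Finset.card_univ, Fintype.card_fin] at h
  rw [← h]
  refine integral_congr_ae (Eventually.of_forall fun ω => ?_)
  simp only [arrivalTime]
  rw [← Complex.exp_sum, ← Finset.mul_sum, Fin.sum_univ_eq_sum_range (fun i => (X i ω : ℂ)) n]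
  push_cast
  rfl

theorem measureReal_arrivalTime_le (hX : IsRenewalSequence P X) {a : ℝ} (ha : a ≤ 0) (n : ℕ)
    (x : ℝ) : P.real {ω | arrivalTime X n ω ≤ x} ≤ Real.exp (-a * x) * mgf (X 0) P a ^ n := by
  have := hX.isProbabilityMeasure
  rw [← hX.mgf_arrivalTime n a]
  refine measure_le_le_exp_mul_mgf x ha (Integrable.of_bound
    (Real.measurable_exp.comp_aemeasurable
      ((hX.aemeasurable_arrivalTime n).const_mul a)).aestronglyMeasurable 1
    ((hX.arrivalTime_nonneg n).mono fun ω hω => ?_))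
  rw [Real.norm_eq_abs, Real.abs_exp]
  exact Real.exp_le_one_iff.2 (mul_nonpos_of_nonpos_of_nonneg ha hω)

theorem summable_mgf_pow (hX : IsRenewalSequence P X) {a : ℝ} (ha : a < 0) :
    Summable fun n : ℕ => mgf (X 0) P a ^ n := by
  have := hX.isProbabilityMeasure
  exact summable_geometric_of_lt_one mgf_nonneg
    (mgf_neg_lt_one (hX.meas 0) (hX.nonneg 0) hX.ne_zero ha)

/-- The Chernoff bound at a = -1 dominates the terms by a geometric series; finiteness of U follows.
-/
theorem summable_measureReal (hX : IsRenewalSequence P X) (x : ℝ) :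
    Summable fun n => P.real {ω | arrivalTime X n ω ≤ x} :=
  Summable.of_nonneg_of_le (fun n => measureReal_nonneg)
    (fun n => hX.measureReal_arrivalTime_le (a := -1) (by norm_num) n x)
    ((hX.summable_mgf_pow (by norm_num)).mul_left _)

theorem expectedCount_eq (hX : IsRenewalSequence P X) (x : ℝ) :
    expectedCount P X x = ENNReal.ofReal (∑' n, P.real {ω | arrivalTime X n ω ≤ x}) := by
  have := hX.isProbabilityMeasure
  have hm : ∀ n, NullMeasurableSet {ω | arrivalTime X n ω ≤ x} P := fun n =>
    nullMeasurableSet_le (hX.aemeasurable_arrivalTime n) aemeasurable_const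
  rw [ENNReal.ofReal_tsum_of_nonneg (fun n => measureReal_nonneg) (hX.summable_measureReal x)]
  simp only [expectedCount, count]
  rw [lintegral_tsum fun n => aemeasurable_const.indicator₀ (hm n)]
  refine tsum_congr fun n => ?_
  rw [lintegral_indicator_const₀ (hm n), one_mul, ofReal_measureReal]

theorem expectedCount_lt_top (hX : IsRenewalSequence P X) (x : ℝ) : expectedCount P X x < ⊤ := by
  rw [hX.expectedCount_eq]; exact ENNReal.ofReal_lt_top

theorem renewalFunction_eq (hX : IsRenewalSequence P X) (x : ℝ) :
    renewalFunction P X x = ∑' n, P.real {ω | arrivalTime X n ω ≤ x} := by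
  rw [renewalFunction, hX.expectedCount_eq,
    ENNReal.toReal_ofReal (tsum_nonneg fun n => measureReal_nonneg)]

theorem continuous_complexMGF (hX : IsRenewalSequence P X) (hR : 0 < expMomentBound P (X 0))
    {a : ℝ} (ha : a ≤ 0) : Continuous fun θ : ℝ => complexMGF (X 0) P (a + θ * Complex.I) := by
  rw [continuous_iff_continuousAt]
  intro θ
  refine ContinuousAt.comp (f := fun θ : ℝ => (a : ℂ) + θ * Complex.I)
    (analyticAt_complexMGF (mem_interior_integrableExpSet (hX.meas 0) (hX.nonneg 0)
      (IsMeromorphicExtension.lt_of_re_nonpos hR (by simpa using ha)))).continuousAt (by fun_prop)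

/-- If `Ψ(s) = ∫ k(θ) e^{(a + iθ) s} dν(θ)` at the values of the arrival times, then
`∑ E[Ψ(S_n)] = ∫ k(θ) / (1 - g(a + iθ)) dν(θ)`. -/
theorem hasSum_integral (hX : IsRenewalSequence P X) (hR : 0 < expMomentBound P (X 0))
    {a : ℝ} (ha : a < 0) {ν : Measure ℝ} [SFinite ν] {k : ℝ → ℂ} (hk : Integrable k ν)
    {Ψ : ℝ → ℂ} (hΨ : ∀ n, ∀ᵐ ω ∂P, Ψ (arrivalTime X n ω)
      = ∫ θ, k θ * Complex.exp ((a + θ * Complex.I) * arrivalTime X n ω) ∂ν) :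
    HasSum (fun n => ∫ ω, Ψ (arrivalTime X n ω) ∂P)
      (∫ θ, k θ * (1 - complexMGF (X 0) P (a + θ * Complex.I))⁻¹ ∂ν) := by
  have := hX.isProbabilityMeasure
  have hlt := mgf_neg_lt_one (hX.meas 0) (hX.nonneg 0) hX.ne_zero ha
  have hbd : ∀ θ : ℝ, ‖complexMGF (X 0) P (a + θ * Complex.I)‖ ≤ mgf (X 0) P a := fun θ => by
    simpa using norm_complexMGF_le_mgf (X := X 0) (μ := P) (z := a + θ * Complex.I)
  have hcont := hX.continuous_complexMGF hR ha.le
  have e1 : ∀ n, ∫ ω, Ψ (arrivalTime X n ω) ∂P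
      = ∫ θ, k θ * complexMGF (X 0) P (a + θ * Complex.I) ^ n ∂ν := by
    intro n
    rw [integral_congr_ae (hΨ n), integral_integral_swap]
    · refine integral_congr_ae (Eventually.of_forall fun θ => ?_)
      simp only
      rw [integral_const_mul, ← hX.complexMGF_arrivalTime n]
      rfl
    -- Fubini applies because the exponential has modulus at most 1: Re z = a < 0 and S_n ≥ 0, so
    -- ‖k‖ dominates.
    · refine Integrable.mono (hk.norm.comp_snd P) ?_ ?_
      · refine AEStronglyMeasurable.mul hk.1.comp_snd ?_
        refine (Complex.measurable_exp.comp_aemeasurable ?_).aestronglyMeasurable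
        refine AEMeasurable.mul (by fun_prop) ?_
        exact Complex.measurable_ofReal.comp_aemeasurable
          ((hX.aemeasurable_arrivalTime n).comp_fst)
      · have h := (Measure.quasiMeasurePreserving_fst (μ := P) (ν := ν)).ae
          (hX.arrivalTime_nonneg n)
        filter_upwards [h] with p hp
        simp only [Function.uncurry, norm_mul, norm_norm]
        exact mul_le_of_le_one_right (norm_nonneg _)
          (norm_cexp_mul_le_one (by simpa using ha.le) hp)
  have hint : ∀ n, Integrable (fun θ => k θ * complexMGF (X 0) P (a + θ * Complex.I) ^ n) ν := by
    intro n
    refine hk.mul_bdd (c := 1) ((hcont.pow n).aestronglyMeasurable)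
      (Eventually.of_forall fun θ => ?_)
    rw [norm_pow]
    exact pow_le_one₀ (norm_nonneg _) ((hbd θ).trans hlt.le)
  have key := hasSum_integral_of_summable_integral_norm hint ?_
  · simp only [← e1] at key
    convert! key using 1
    refine integral_congr_ae (Eventually.of_forall fun θ => ?_)
    simp only
    rw [tsum_mul_left, tsum_geometric_of_norm_lt_one ((hbd θ).trans_lt hlt)]
  -- Sum and integral are exchanged by comparing the n-th norm with mgf(a)^n ∫ ‖k‖.
  · refine Summable.of_nonneg_of_le (fun n => integral_nonneg fun θ => norm_nonneg _) (fun n => ?_)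
      ((hX.summable_mgf_pow ha).mul_left (∫ θ, ‖k θ‖ ∂ν))
    rw [← integral_mul_const]
    refine integral_mono (hint n).norm (hk.norm.mul_const _) fun θ => ?_
    simp only [norm_mul, norm_pow]
    gcongr
    exact hbd θ

end IsRenewalSequence

section

variable {Ω : Type*} [MeasurableSpace Ω] {P : Measure Ω} {X : ℕ → Ω → ℝ} {G : ℂ → ℂ}

/-- The residue at the origin of `φ(z) / (z (1 - G(z)))`. -/
theorem residue_zero (hX : IsRenewalSequence P X) (hR : 0 < expMomentBound P (X 0))
    (hG : IsMeromorphicExtension P (X 0) G) {f φ : ℂ → ℂ} (hφ : AnalyticAt ℂ φ 0)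
    (hf : ∀ᶠ z in 𝓝[≠] 0, f z = φ z / z * recipExt G z) :
    residue f 0 = -(deriv φ 0 * (∫ ω, X 0 ω ∂P : ℝ) - φ 0 * ((∫ ω, X 0 ω ^ 2 ∂P : ℝ) / 2))
      / (∫ ω, X 0 ω ∂P : ℝ) ^ 2 := by
  have := hX.isProbabilityMeasure
  have hGa : AnalyticAt ℂ G 0 := hG.analyticAt (hX.meas 0) (hX.nonneg 0) (by simpa using hR)
  obtain ⟨B, hB, eB, B0, B1⟩ := exists_eq_add_mul hGa
  rw [hG.apply_zero hR] at eB
  rw [hG.deriv_zero (hX.meas 0) (hX.nonneg 0) hR] at B0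
  rw [hG.deriv_deriv_zero (hX.meas 0) (hX.nonneg 0) hR] at B1
  have hμ := integral_pos_of_not_ae_zero (hX.nonneg 0) (IsMeromorphicExtension.integrable
    (hX.meas 0) (hX.nonneg 0) hR) hX.ne_zero
  have hB0 : B 0 ≠ 0 := by rw [B0]; exact_mod_cast hμ.ne'
  -- With G = 1 + zB, the function is -(φ/B)/z², so its residue is (-(φ/B))'(0), where B(0) = μ and
  -- B'(0) = μ₂/2.
  have key := residue_of_double_pole (f := f) (F := fun z => -(φ z / B z)) (s := 0)
    ((hφ.div hB hB0).neg) ?_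
  · rw [key]
    have h := ((hφ.differentiableAt.hasDerivAt.div hB.differentiableAt.hasDerivAt hB0).neg).deriv
    have h' : deriv (fun z => -(φ z / B z)) 0 = _ := h
    rw [h', B0, B1]
    ring
  · filter_upwards [hf, recipExt_eventuallyEq hGa.meromorphicAt] with z hz1 hz2
    rw [hz1, hz2, eB z]
    simp only [sub_zero, div_eq_mul_inv, sub_add_cancel_left, inv_neg, mul_inv]
    ring

end

/-! ### The lattice case -/

theorem integral_cexp_int_mul (n : ℤ) (a t : ℝ) :
    ∫ θ in (t - Real.pi)..(t + Real.pi), Complex.exp (n * (a + θ * Complex.I))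
      = if n = 0 then 2 * (Real.pi : ℂ) else 0 := by
  split_ifs with hn
  · subst hn
    simp only [Int.cast_zero, zero_mul, Complex.exp_zero, intervalIntegral.integral_const]
    simp; ring
  · have hc : (n : ℂ) * Complex.I ≠ 0 := mul_ne_zero (by exact_mod_cast hn) Complex.I_ne_zero
    have e : ∀ θ : ℝ, Complex.exp (n * (a + θ * Complex.I))
        = Complex.exp (n * a) * Complex.exp (n * Complex.I * θ) := fun θ => by
      rw [← Complex.exp_add]; ring_nf
    simp only [e]
    rw [intervalIntegral.integral_const_mul, integral_exp_mul_complex hc]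
    have e2 : (n : ℂ) * Complex.I * ((t + Real.pi : ℝ) : ℂ)
        = n * Complex.I * ((t - Real.pi : ℝ) : ℂ) + n * (2 * Real.pi * Complex.I) := by
      push_cast; ring
    rw [e2, Complex.exp_add, Complex.exp_int_mul_two_pi_mul_I]
    simp

/-- Expand 1/(1 - e^z) = ∑ e^{jz}, which converges since a < 0. By orthogonality only j = -l
survives, and it is a natural number exactly when l ≤ 0. With l = S_n - k this detects S_n ≤ k. -/
theorem integral_cexp_div (l : ℤ) {a : ℝ} (ha : a < 0) (t : ℝ) :
    ∫ θ in (t - Real.pi)..(t + Real.pi),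
      Complex.exp (l * (a + θ * Complex.I)) * (1 - Complex.exp (a + θ * Complex.I))⁻¹
      = if l ≤ 0 then 2 * (Real.pi : ℂ) else 0 := by
  have hle : t - Real.pi ≤ t + Real.pi := by linarith [Real.pi_pos]
  have hcont : ∀ j : ℕ, Continuous fun θ : ℝ =>
      Complex.exp (((l + j : ℤ) : ℂ) * (a + θ * Complex.I)) := fun j => by fun_prop
  have hnorm : ∀ (j : ℕ) (θ : ℝ), ‖Complex.exp (((l + j : ℤ) : ℂ) * (a + θ * Complex.I))‖
      = Real.exp (l * a) * Real.exp a ^ j := fun j θ => by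
    rw [Complex.norm_exp, ← Real.exp_nat_mul, ← Real.exp_add]
    congr 1
    simp; ring
  have key := hasSum_integral_of_summable_integral_norm
    (μ := volume.restrict (Set.Ioc (t - Real.pi) (t + Real.pi)))
    (F := fun (j : ℕ) (θ : ℝ) => Complex.exp (((l + j : ℤ) : ℂ) * (a + θ * Complex.I)))
    (fun j => (intervalIntegrable_iff_integrableOn_Ioc_of_le hle).1
      ((hcont j).intervalIntegrable _ _)) ?_
  · simp only [← intervalIntegral.integral_of_le hle, integral_cexp_int_mul] at key
    have e : ∀ θ : ℝ, ∑' j : ℕ, Complex.exp (((l + j : ℤ) : ℂ) * (a + θ * Complex.I))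
        = Complex.exp (l * (a + θ * Complex.I)) * (1 - Complex.exp (a + θ * Complex.I))⁻¹ := by
      intro θ
      rw [← tsum_geometric_of_norm_lt_one (by simpa [Complex.norm_exp] using ha), ← tsum_mul_left]
      refine tsum_congr fun j => ?_
      rw [← Complex.exp_nat_mul, ← Complex.exp_add]
      push_cast; ring_nf
    simp only [e] at key
    refine key.unique ?_
    split_ifs with hl
    · have h := hasSum_single (f := fun j : ℕ => if l + j = 0 then 2 * (Real.pi : ℂ) else 0)
        (-l).toNat fun j hj => if_neg (by omega)
      rwa [if_pos (by omega)] at h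
    · have h : (fun j : ℕ => if l + j = 0 then 2 * (Real.pi : ℂ) else 0) = fun _ => 0 :=
        funext fun j => if_neg (by omega)
      rw [h]
      exact hasSum_zero
  · simp only [hnorm, integral_const]
    exact ((summable_geometric_of_lt_one (Real.exp_pos a).le
      (Real.exp_lt_one_iff.2 ha)).mul_left _).mul_left _

section

variable {Ω : Type*} [MeasurableSpace Ω] {P : Measure Ω} {X : ℕ → Ω → ℝ} {G : ℂ → ℂ}

theorem isLattice_of_hasMesh {F : Measure ℝ} {h : ℝ} (hF : HasMesh F h) : IsLattice F :=
  ⟨h, hF.1, hF.2.1⟩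

theorem measure_map_multiples_of_ae_zero {Y : Ω → ℝ} (hY : AEMeasurable Y P) (h0 : Y =ᵐ[P] 0)
    (h : ℝ) : P.map Y (multiples h)ᶜ = 0 := by
  have hm : MeasurableSet (multiples h) := (Set.countable_range _).measurableSet
  rw [Measure.map_apply_of_aemeasurable hY hm.compl]
  refine measure_mono_null (fun ω hω => ?_) h0
  intro h1
  exact hω ⟨0, by simpa using h1.symm⟩

/-- The zero variable is supported by every lattice, so it has no largest mesh. -/
theorem not_ae_zero_of_hasMesh {Y : Ω → ℝ} (hY : AEMeasurable Y P) {h : ℝ}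
    (hF : HasMesh (P.map Y) h) : ¬ Y =ᵐ[P] 0 := fun h0 =>
  hF.2.2 (h + 1) (by linarith) (measure_map_multiples_of_ae_zero hY h0 _)

theorem not_ae_zero_of_not_isLattice {Y : Ω → ℝ} (hY : AEMeasurable Y P)
    (hF : ¬ IsLattice (P.map Y)) : ¬ Y =ᵐ[P] 0 := fun h0 =>
  hF ⟨1, one_pos, measure_map_multiples_of_ae_zero hY h0 _⟩

theorem ae_exists_nat_of_hasMesh {Y : Ω → ℝ} (hY : AEMeasurable Y P)
    (hF : HasMesh (P.map Y) 1) : ∀ᵐ ω ∂P, ∃ n : ℕ, Y ω = n := by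
  have h := ae_of_ae_map hY (mem_ae_iff.2 hF.2.1)
  filter_upwards [h] with ω ⟨n, hn⟩
  exact ⟨n, by simpa using hn.symm⟩

theorem IsRenewalSequence.ae_exists_nat (hX : IsRenewalSequence P X)
    (hF : HasMesh (P.map (X 0)) 1) (n : ℕ) : ∀ᵐ ω ∂P, ∃ m : ℕ, arrivalTime X n ω = m := by
  have h : ∀ i, ∀ᵐ ω ∂P, ∃ m : ℕ, X i ω = m := fun i =>
    ae_exists_nat_of_hasMesh (hX.meas i) (by rw [(hX.ident i).map_eq]; exact hF)
  filter_upwards [ae_all_iff.2 h] with ω hω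
  choose m hm using hω
  exact ⟨∑ i ∈ Finset.range n, m i, by simp [arrivalTime, hm]⟩

/-- For Re z < 0 the periodicity is that of e^{zY} with Y integer-valued; the identity theorem
carries it to the meromorphic extension. -/
theorem add_two_pi_I (hY : AEMeasurable (X 0) P) (hR : 0 < expMomentBound P (X 0))
    (hG : IsMeromorphicExtension P (X 0) G) (hF : HasMesh (P.map (X 0)) 1) (z : ℂ) :
    G (z + 2 * Real.pi * Complex.I) = G z := by
  have h1 : MeromorphicNFOn (fun z => G (z + 2 * Real.pi * Complex.I)) Set.univ := by
    intro u _
    exact meromorphicNFAt_comp_add_const_iff_meromorphicNFAt.2 (hG.meromorphic (Set.mem_univ _))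
  refine congrFun (eq_of_eventuallyEq (z := -1) h1 hG.meromorphic ?_) z
  filter_upwards [(isOpen_Iio.preimage Complex.continuous_re).mem_nhds
    (show (-1 : ℂ) ∈ Complex.re ⁻¹' Set.Iio 0 by simp)] with w hw
  have hw' : w.re ≤ 0 := le_of_lt hw
  rw [hG.eq_of_re_nonpos hR (by simpa using hw'), hG.eq_of_re_nonpos hR hw']
  refine integral_congr_ae ?_
  filter_upwards [ae_exists_nat_of_hasMesh hY hF] with ω ⟨n, hn⟩
  simp only [hn]
  rw [Complex.ofReal_natCast, add_mul, Complex.exp_add, mul_comm (2 * Real.pi * Complex.I),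
    Complex.exp_nat_mul_two_pi_mul_I, mul_one]

theorem analyticAt_add_iff {c : ℂ} (hc : ∀ z, G (z + c) = G z) (z : ℂ) :
    AnalyticAt ℂ G (z + c) ↔ AnalyticAt ℂ G z := by
  constructor <;> intro h
  · have := AnalyticAt.comp (f := fun w => w + c) (x := z) h (by fun_prop)
    rwa [show G ∘ (fun w => w + c) = G from funext hc] at this
  · have hc' : ∀ z, G (z - c) = G z := fun z => by rw [← hc, sub_add_cancel]
    have := AnalyticAt.comp (g := G) (f := fun w => w - c) (x := z + c) (by simpa using h)
      (by fun_prop)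
    rwa [show G ∘ (fun w => w - c) = G from funext hc'] at this

theorem recipExt_add {c : ℂ} (hc : ∀ z, G (z + c) = G z) (z : ℂ) :
    recipExt G (z + c) = recipExt G z := by
  unfold recipExt
  rw [hc]
  have h := analyticAt_add_iff hc z
  split_ifs <;> first | rfl | tauto

theorem absRecip_add {c : ℂ} (hc : ∀ z, G (z + c) = G z) (z : ℂ) :
    absRecip G (z + c) = absRecip G z := by
  unfold absRecip
  rw [hc]
  have h := analyticAt_add_iff hc z
  split_ifs <;> first | rfl | tauto

/-- Contour integral formula for the renewal function at the integers. -/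
theorem renewalFunction_lattice (hX : IsRenewalSequence P X) (hR : 0 < expMomentBound P (X 0))
    (hG : IsMeromorphicExtension P (X 0) G) (hF : HasMesh (P.map (X 0)) 1) (k : ℕ) (t : ℝ) {a : ℝ}
    (ha : a < 0) :
    ∫ θ in (t - Real.pi)..(t + Real.pi), Complex.exp (-(k * (a + θ * Complex.I))) /
      (Complex.exp (a + θ * Complex.I) - 1) * recipExt G (a + θ * Complex.I)
      = -(2 * Real.pi * (renewalFunction P X k : ℂ)) := by
  have := hX.isProbabilityMeasure
  have hle : t - Real.pi ≤ t + Real.pi := by linarith [Real.pi_pos]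
  have hpi : (Real.pi : ℂ) ≠ 0 := by exact_mod_cast Real.pi_ne_zero
  have hne : ∀ θ : ℝ, 1 - Complex.exp (a + θ * Complex.I) ≠ 0 := fun θ h => by
    have h1 := congrArg norm (sub_eq_zero.1 h)
    rw [Complex.norm_exp] at h1
    simp only [norm_one, Complex.add_re, Complex.ofReal_re, Complex.re_ofReal_mul, Complex.I_re,
      mul_zero, add_zero] at h1
    exact (Real.exp_lt_one_iff.2 ha).ne h1.symm
  have hk : Integrable (fun θ : ℝ => Complex.exp (((-k : ℤ) : ℂ) * (a + θ * Complex.I)) *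
      (1 - Complex.exp (a + θ * Complex.I))⁻¹)
      (volume.restrict (Set.Ioc (t - Real.pi) (t + Real.pi))) := by
    refine (intervalIntegrable_iff_integrableOn_Ioc_of_le hle).1
      (Continuous.intervalIntegrable ?_ _ _)
    exact Continuous.mul (by fun_prop) (Continuous.inv₀ (by fun_prop) hne)
  -- The representation of 2π times the indicator of s ≤ k holds at integers s only, hence only
  -- almost surely along the arrival times.
  have key := hX.hasSum_integral hR ha hk
    (Ψ := fun s => if s ≤ k then 2 * (Real.pi : ℂ) else 0) fun n => by
      filter_upwards [hX.ae_exists_nat hF n] with ω ⟨m, hm⟩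
      rw [hm, ← intervalIntegral.integral_of_le hle]
      have h := integral_cexp_div ((m : ℤ) - k) ha t
      have e : (fun θ : ℝ => Complex.exp (((-k : ℤ) : ℂ) * (a + θ * Complex.I)) *
          (1 - Complex.exp (a + θ * Complex.I))⁻¹ *
          Complex.exp ((a + θ * Complex.I) * ((m : ℝ) : ℂ))) = fun θ : ℝ =>
          Complex.exp ((((m : ℤ) - k : ℤ) : ℂ) * (a + θ * Complex.I)) *
            (1 - Complex.exp (a + θ * Complex.I))⁻¹ := by
        funext θ
        rw [mul_right_comm, ← Complex.exp_add]
        congr 2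
        push_cast; ring
      rw [e, h]
      simp
  have e1 : ∀ n, ∫ ω, (if arrivalTime X n ω ≤ k then 2 * (Real.pi : ℂ) else 0) ∂P
      = 2 * Real.pi * (P.real {ω | arrivalTime X n ω ≤ k} : ℂ) := fun n => by
    have h := integral_indicator₀ (μ := P) (f := fun _ => 2 * (Real.pi : ℂ))
      (nullMeasurableSet_le (hX.aemeasurable_arrivalTime n) (aemeasurable_const (b := (k : ℝ))))
    rw [setIntegral_const] at h
    rw [mul_comm _ (P.real _ : ℂ), ← Complex.real_smul, ← h]
    rfl
  simp only [e1] at key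
  have h2 : HasSum (fun n => 2 * Real.pi * (P.real {ω | arrivalTime X n ω ≤ k} : ℂ))
      (2 * Real.pi * (renewalFunction P X k : ℂ)) := by
    rw [hX.renewalFunction_eq]
    exact (Complex.hasSum_ofReal.2 (hX.summable_measureReal k).hasSum).mul_left _
  rw [h2.unique key, ← intervalIntegral.integral_of_le hle, ← intervalIntegral.integral_neg]
  refine intervalIntegral.integral_congr fun θ _ => ?_
  have hre : ((a : ℂ) + θ * Complex.I).re ≤ 0 := by simpa using ha.le
  have hGa := hG.analyticAt (hX.meas 0) (hX.nonneg 0) (z := a + θ * Complex.I)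
    (IsMeromorphicExtension.lt_of_re_nonpos hR hre)
  rw [(recipExt_eventuallyEq_nhds hGa).eq_of_nhds, hG.eq_of_re_nonpos hR hre,
    ← neg_sub (1 : ℂ) (Complex.exp _), div_neg, div_eq_mul_inv]
  simp

/-- Periodicity extends the supremum over one period to the whole line. A finite supremum also
excludes roots on Re z = r, since `absRecip` is infinite there. -/
theorem latticeSup_bound (hX : IsRenewalSequence P X) (hR : 0 < expMomentBound P (X 0))
    (hG : IsMeromorphicExtension P (X 0) G) (hF : HasMesh (P.map (X 0)) 1) {r : ℝ}
    (hr : latticeSup G r ≠ ⊤) (θ : ℝ) :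
    G (r + θ * Complex.I) ≠ 1 ∧
      ‖recipExt G (r + θ * Complex.I)‖ ≤ (latticeSup G r).toReal * Real.exp r := by
  have hper := add_two_pi_I (hX.meas 0) hR hG hF
  have hr0 : ENNReal.ofReal (Real.exp r) ≠ 0 := by simpa using Real.exp_pos r
  have h1 : ∀ θ ∈ Set.Icc (-Real.pi) Real.pi, absRecip G (r + θ * Complex.I)
      ≤ latticeSup G r * ENNReal.ofReal (Real.exp r) := fun θ hθ =>
    (ENNReal.div_le_iff hr0 ENNReal.ofReal_ne_top).1
      (le_iSup₂ (f := fun (θ : ℝ) (_ : θ ∈ Set.Icc (-Real.pi) Real.pi) =>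
        absRecip G (r + θ * Complex.I) / ENNReal.ofReal (Real.exp r)) θ hθ)
  have hperZ : Function.Periodic (fun θ : ℝ => absRecip G (r + θ * Complex.I)) (2 * Real.pi) := by
    intro θ
    have := absRecip_add hper (r + θ * Complex.I)
    refine Eq.trans (congrArg (absRecip G) ?_) this
    push_cast; ring
  have h2 : absRecip G (r + θ * Complex.I) ≤ latticeSup G r * ENNReal.ofReal (Real.exp r) := by
    obtain ⟨y, hy, e⟩ := hperZ.exists_mem_Ico (by positivity) θ (-Real.pi)
    exact e.le.trans <| h1 y ⟨hy.1, by linarith [hy.2]⟩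
  have := norm_recipExt_le (ENNReal.mul_ne_top hr ENNReal.ofReal_ne_top)
    (hG.meromorphic (Set.mem_univ _)) h2
  rwa [ENNReal.toReal_mul, ENNReal.toReal_ofReal (Real.exp_pos r).le] at this

/-- Roots have Re z ≥ 0, so those to the left of r lie in a compact rectangle. -/
theorem finite_latticeRoots (hX : IsRenewalSequence P X) (hR : 0 < expMomentBound P (X 0))
    (hG : IsMeromorphicExtension P (X 0) G) (r : ℝ) :
    {z ∈ latticeRoots G | z.re < r}.Finite := by
  have := hX.isProbabilityMeasure
  refine (hG.finite_roots (hX.meas 0) (hX.nonneg 0) hX.ne_zero hR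
    (isCompact_Icc.reProdIm (isCompact_Icc (a := -Real.pi) (b := Real.pi)) :
      IsCompact (Set.Icc 0 r ×ℂ _))).subset ?_
  rintro z ⟨⟨h1, h2, h3⟩, h4⟩
  exact ⟨⟨⟨hG.re_nonneg_of_eq_one (hX.meas 0) (hX.nonneg 0) hX.ne_zero hR h3, h4.le⟩,
    ⟨h1.le, h2⟩⟩, h3⟩

/-- Roots may lie on Im z = π, the edge of the fundamental strip. Raising the window by ε puts them
in its interior and loses no root at the bottom. -/
theorem exists_gap {S : Set ℂ} (hS : S.Finite) (h : ∀ z ∈ S, -Real.pi < z.im) :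
    ∃ ε : ℝ, 0 < ε ∧ ε < Real.pi ∧ ∀ z ∈ S, -Real.pi + ε < z.im := by
  have h1 : ∀ᶠ ε in 𝓝[>] (0 : ℝ), ∀ z ∈ S, -Real.pi + ε < z.im := by
    rw [eventually_all_finite hS]
    intro z hz
    have : Tendsto (fun ε : ℝ => -Real.pi + ε) (𝓝[>] 0) (𝓝 (-Real.pi + 0)) :=
      (Continuous.tendsto (by fun_prop) 0).mono_left nhdsWithin_le_nhds
    exact this.eventually_lt_const (by simpa using h z hz)
  obtain ⟨ε, h1, h2⟩ := (h1.and (Ioo_mem_nhdsGT Real.pi_pos)).exists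
  exact ⟨ε, h2.1, h2.2, h1⟩

/-- Here e^z - 1 = zA with A(0) = 1 and A'(0) = 1/2. The derivative A'(0) produces the additional
1/(2μ) peculiar to the lattice case. -/
theorem latticeResidue_zero (hX : IsRenewalSequence P X) (hR : 0 < expMomentBound P (X 0))
    (hG : IsMeromorphicExtension P (X 0) G) (k : ℕ) :
    residue (fun z => Complex.exp (-(k * z)) / (Complex.exp z - 1) * recipExt G z) 0
      = ((k / (∫ ω, X 0 ω ∂P) + ((∫ ω, X 0 ω ^ 2 ∂P) + ∫ ω, X 0 ω ∂P) /
        (2 * (∫ ω, X 0 ω ∂P) ^ 2) : ℝ) : ℂ) := by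
  have hμ := integral_pos_of_not_ae_zero (hX.nonneg 0) (IsMeromorphicExtension.integrable
    (hX.meas 0) (hX.nonneg 0) hR) hX.ne_zero
  obtain ⟨A, hA, eA, A0, A1⟩ := exists_eq_add_mul (f := Complex.exp) (c := 0)
    (by fun_prop)
  simp only [Complex.deriv_exp, Complex.exp_zero] at A0 A1 eA
  have hd : HasDerivAt (fun z : ℂ => Complex.exp (-(k * z)) / A z) _ 0 :=
    HasDerivAt.div (((hasDerivAt_id (0 : ℂ)).const_mul (k : ℂ)).neg.cexp)
      hA.differentiableAt.hasDerivAt (by simp [A0])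
  rw [residue_zero hX hR hG (φ := fun z => Complex.exp (-(k * z)) / A z), hd.deriv]
  · simp only [A0, A1, id, Pi.neg_apply, mul_zero, neg_zero, Complex.exp_zero]
    have : ((∫ ω, X 0 ω ∂P : ℝ) : ℂ) ≠ 0 := by exact_mod_cast hμ.ne'
    push_cast
    field_simp
    ring
  · exact AnalyticAt.div (by fun_prop) hA (by simp [A0])
  · refine Eventually.of_forall fun z => ?_
    rw [eA z]
    simp only [sub_zero, add_sub_cancel_left]
    rw [div_div, mul_comm z]

theorem remainder_lattice (hX : IsRenewalSequence P X) (hR : 0 < expMomentBound P (X 0))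
    (hG : IsMeromorphicExtension P (X 0) G) (hF : HasMesh (P.map (X 0)) 1) (k : ℕ) {r : ℝ}
    (hr1 : 1 ≤ r) (hr : latticeSup G r ≠ ⊤) :
    ‖(remainder P X k : ℂ) - ∑ᶠ z ∈ {z ∈ latticeRoots G \ {0} | z.re < r}, latticeResidue G k z‖
      ≤ 2 * (latticeSup G r).toReal := by
  classical
  have := hX.isProbabilityMeasure
  have hpi := Real.pi_pos
  have hper := add_two_pi_I (hX.meas 0) hR hG hF
  have hfin0 := finite_latticeRoots hX hR hG (r + 1)
  have hfin : {z ∈ latticeRoots G \ {0} | z.re < r}.Finite :=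
    hfin0.subset fun z hz => ⟨hz.1.1, hz.2.trans (by linarith)⟩
  obtain ⟨ε, hε0, hε1, hε⟩ := exists_gap hfin0 fun z hz => hz.1.1
  set f : ℂ → ℂ := fun z => Complex.exp (-(k * z)) / (Complex.exp z - 1) * recipExt G z with hf
  have hroot : ∀ z ∈ closedRect (-1) r (ε - Real.pi) (ε + Real.pi), G z = 1 →
      z ∈ insert 0 hfin.toFinset ∧ z ∈ openRect (-1) r (ε - Real.pi) (ε + Real.pi) := by
    rintro z ⟨⟨h1, h2⟩, h3, h4⟩ hz
    have hre := hG.re_nonneg_of_eq_one (hX.meas 0) (hX.nonneg 0) hX.ne_zero hR hz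
    have hre' : z.re < r := h2.lt_of_ne fun h => by
      refine (latticeSup_bound hX hR hG hF hr z.im).1 ?_
      rw [← h, Complex.re_add_im]; exact hz
    -- A root above height π, moved down by 2πi, would have imaginary part in (-π, -π + ε], which
    -- the choice of ε forbids.
    have him : z.im ≤ Real.pi := by
      by_contra! him
      have hz' : G (z - 2 * Real.pi * Complex.I) = 1 := by rw [← hper, sub_add_cancel]; exact hz
      have h5 : (z - 2 * Real.pi * Complex.I).im = z.im - 2 * Real.pi := by simp
      have h6 : (z - 2 * Real.pi * Complex.I).re = z.re := by simp
      have := hε (z - 2 * Real.pi * Complex.I)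
        ⟨⟨by rw [h5]; linarith, by rw [h5]; linarith, hz'⟩, by rw [h6]; linarith⟩
      rw [h5] at this
      linarith
    have hmem : z ∈ latticeRoots G := ⟨by linarith, him, hz⟩
    have := hε z ⟨hmem, by linarith⟩
    refine ⟨?_, ⟨by linarith, hre'⟩, by linarith, by linarith⟩
    by_cases h0 : z = 0
    · simp [h0]
    · simp only [Finset.mem_insert, Set.Finite.mem_toFinset]
      exact Or.inr ⟨⟨hmem, h0⟩, hre'⟩
  have hSone : ∀ z ∈ insert 0 hfin.toFinset, G z = 1 ∧
      z ∈ openRect (-1) r (ε - Real.pi) (ε + Real.pi) := by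
    intro z hz
    have hz1 : G z = 1 := by
      rcases Finset.mem_insert.1 hz with rfl | hz
      · exact hG.apply_zero hR
      · exact ((Set.Finite.mem_toFinset hfin).1 hz).1.1.2.2
    refine ⟨hz1, (hroot z ?_ hz1).2⟩
    rcases Finset.mem_insert.1 hz with rfl | hz
    · exact ⟨⟨by simp, by simp; linarith⟩, by simp; linarith, by simp; linarith⟩
    · have h := (Set.Finite.mem_toFinset hfin).1 hz
      have hre := hG.re_nonneg_of_eq_one (hX.meas 0) (hX.nonneg 0) hX.ne_zero hR hz1
      have := hε z ⟨h.1.1, h.2.trans (by linarith)⟩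
      exact ⟨⟨by linarith, h.2.le⟩, by linarith, by linarith [h.1.1.2.1]⟩
  -- As 0 < ε < π, the window contains no multiple of 2πi other than 0.
  have hexp : ∀ z ∈ closedRect (-1) r (ε - Real.pi) (ε + Real.pi), z ≠ 0 →
      Complex.exp z - 1 ≠ 0 := by
    rintro z ⟨-, h3, h4⟩ hz h
    obtain ⟨n, hn⟩ := Complex.exp_eq_one_iff.1 (sub_eq_zero.1 h)
    have him : z.im = n * (2 * Real.pi) := by rw [hn]; simp
    rw [him] at h3 h4
    have h5 : (n : ℝ) < 1 := by nlinarith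
    have h6 : (-1 : ℝ) < n := by nlinarith
    have h7 : n = 0 := by
      have : n < 1 := by exact_mod_cast h5
      have : -1 < n := by exact_mod_cast h6
      omega
    exact hz (by rw [hn, h7]; simp)
  have hres := rectIntegral_eq_sum_residue (a := -1) (b := r) (c := ε - Real.pi) (d := ε + Real.pi)
    (by linarith) (by linarith) (insert 0 hfin.toFinset) f (fun s hs => (hSone s hs).2)
    (fun s _ => by
      have hN : AnalyticAt ℂ (fun z : ℂ => Complex.exp (-(k * z))) s := by fun_prop
      have hE : AnalyticAt ℂ (fun z : ℂ => Complex.exp z - 1) s := by fun_prop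
      exact (hN.meromorphicAt.div hE.meromorphicAt).mul
        (meromorphicAt_recipExt (hG.meromorphic (Set.mem_univ s)).meromorphicAt))
    (fun z hz hzS => by
      have h0 : z ≠ 0 := fun h => hzS (by simp [h])
      have h1 : G z ≠ 1 := fun h => hzS (hroot z hz h).1
      exact DifferentiableAt.mul (DifferentiableAt.div (by fun_prop) (by fun_prop) (hexp z hz h0))
        (differentiableAt_recipExt (hG.meromorphic (Set.mem_univ z)) h1))
  have hfper : ∀ x : ℝ, f (x + (ε + Real.pi : ℝ) * Complex.I)
      = f (x + (ε - Real.pi : ℝ) * Complex.I) := by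
    intro x
    have e : (x : ℂ) + (ε + Real.pi : ℝ) * Complex.I
        = x + (ε - Real.pi : ℝ) * Complex.I + 2 * Real.pi * Complex.I := by push_cast; ring
    have e2 : ∀ w : ℂ, Complex.exp (-(k * (w + 2 * Real.pi * Complex.I)))
        = Complex.exp (-(k * w)) := fun w => by
      rw [show -(k * (w + 2 * Real.pi * Complex.I))
        = -(k * w) + ((-k : ℤ) : ℂ) * (2 * Real.pi * Complex.I) by push_cast; ring,
        Complex.exp_add, Complex.exp_int_mul_two_pi_mul_I, mul_one]
    rw [e, hf]
    simp only
    rw [recipExt_add hper, Complex.exp_periodic, e2]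
  have hleft := renewalFunction_lattice hX hR hG hF k ε (a := -1) (by norm_num)
  have hsum : ∑ s ∈ insert 0 hfin.toFinset, residue f s = residue f 0 +
      ∑ᶠ z ∈ {z ∈ latticeRoots G \ {0} | z.re < r}, latticeResidue G k z := by
    rw [Finset.sum_insert (by simp), finsum_mem_eq_finite_toFinset_sum _ hfin]
    congr 1
    refine Finset.sum_congr rfl fun s _ => residue_congr ?_
    filter_upwards [recipExt_eventuallyEq (hG.meromorphic (Set.mem_univ s)).meromorphicAt] with z hz
    simp only [hf]
    rw [hz, div_mul_eq_div_div, div_eq_mul_inv _ (1 - G z)]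
  rw [hsum, latticeResidue_zero hX hR hG, rectIntegral] at hres
  simp only [hfper, sub_self, zero_add] at hres
  have hrem : (remainder P X k : ℂ) = (renewalFunction P X k : ℂ) -
      ((k / (∫ ω, X 0 ω ∂P) + ((∫ ω, X 0 ω ^ 2 ∂P) + ∫ ω, X 0 ω ∂P) /
        (2 * (∫ ω, X 0 ω ∂P) ^ 2) : ℝ) : ℂ) := by
    rw [remainder, if_pos (isLattice_of_hasMesh hF)]
    push_cast; ring
  have hkey : (remainder P X k : ℂ) -
      ∑ᶠ z ∈ {z ∈ latticeRoots G \ {0} | z.re < r}, latticeResidue G k z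
      = -((2 * (Real.pi : ℂ))⁻¹ * ∫ y in (ε - Real.pi)..(ε + Real.pi), f (r + y * Complex.I)) := by
    have hpi' : (Real.pi : ℂ) ≠ 0 := by exact_mod_cast hpi.ne'
    rw [hleft] at hres
    rw [hrem]
    generalize (k / (∫ ω, X 0 ω ∂P) + ((∫ ω, X 0 ω ^ 2 ∂P) + ∫ ω, X 0 ω ∂P) /
      (2 * (∫ ω, X 0 ω ∂P) ^ 2) : ℝ) = c at hres
    generalize (∑ᶠ z ∈ {z ∈ latticeRoots G \ {0} | z.re < r}, latticeResidue G k z) = t at hres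
    generalize (∫ y in (ε - Real.pi)..(ε + Real.pi), f (r + y * Complex.I)) = J at hres
    have h2 : J = 2 * Real.pi * (c + t - renewalFunction P X k) :=
      mul_left_cancel₀ Complex.I_ne_zero (by linear_combination hres)
    rw [h2]
    field_simp
    ring
  -- Since r ≥ 1, e^r ≥ 2 and |e^z - 1| ≥ e^r/2; this cancels the factor e^r in the bound for 1/(1 -
  -- G) and leaves the constant 2.
  have hbd : ∀ y : ℝ, ‖f (r + y * Complex.I)‖ ≤ 2 * (latticeSup G r).toReal := by
    intro y
    have h1 := (latticeSup_bound hX hR hG hF hr y).2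
    have h2 : ‖Complex.exp (-(k * (r + y * Complex.I)))‖ ≤ 1 := by
      rw [Complex.norm_exp, Real.exp_le_one_iff]
      simp; positivity
    have hexp2 : 2 ≤ Real.exp r := by linarith [Real.add_one_le_exp r]
    have h3 : Real.exp r / 2 ≤ ‖Complex.exp (r + y * Complex.I) - 1‖ := by
      have := norm_sub_norm_le (Complex.exp (r + y * Complex.I)) 1
      rw [Complex.norm_exp] at this
      simp at this
      linarith
    have hpos := Real.exp_pos r
    rw [hf]
    simp only [norm_mul, norm_div]
    calc _ ≤ 1 / (Real.exp r / 2) * ((latticeSup G r).toReal * Real.exp r) := by gcongr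
      _ = _ := by field_simp
  rw [hkey, norm_neg, norm_mul]
  have h4 := intervalIntegral.norm_integral_le_of_norm_le_const (a := ε - Real.pi)
    (b := ε + Real.pi) (f := fun y : ℝ => f (r + y * Complex.I)) fun y _ => hbd y
  have h5 : |ε + Real.pi - (ε - Real.pi)| = 2 * Real.pi := by
    rw [abs_of_nonneg (by linarith)]; ring
  rw [h5] at h4
  have h6 : ‖((2 * Real.pi : ℂ))⁻¹‖ = (2 * Real.pi)⁻¹ := by
    rw [norm_inv, norm_mul, Complex.norm_real]; simp [abs_of_pos hpi]
  rw [h6, inv_mul_le_iff₀ (by positivity)]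
  linarith

end

/-! ### Lattice case: limits along sequences of contours -/

theorem exists_seq_of_liminf_eq_zero {σ : ℝ → ℝ≥0∞} (h : liminf σ atTop = 0) :
    ∃ r : ℕ → ℝ, Tendsto r atTop atTop ∧ Tendsto (fun n => σ (r n)) atTop (𝓝 0) := by
  have h1 : ∀ n : ℕ, ∃ r : ℝ, (n : ℝ) ≤ r ∧ σ r < ((n : ℝ≥0∞) + 1)⁻¹ := fun n => by
    have hf : ∃ᶠ r in atTop, σ r < ((n : ℝ≥0∞) + 1)⁻¹ :=
      frequently_lt_of_liminf_lt (by isBoundedDefault) (by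
        rw [h]; exact ENNReal.inv_pos.2 (by finiteness))
    obtain ⟨r, hr⟩ := (hf.and_eventually (eventually_ge_atTop (n : ℝ))).exists
    exact ⟨r, hr.2, hr.1⟩
  choose r hr1 hr2 using h1
  refine ⟨r, tendsto_atTop_mono hr1 tendsto_natCast_atTop_atTop,
    tendsto_of_tendsto_of_tendsto_of_le_of_le tendsto_const_nhds ?_ (fun n => zero_le)
      fun n => (hr2 n).le⟩
  have := ENNReal.tendsto_inv_nat_nhds_zero.comp (tendsto_add_atTop_nat 1)
  refine this.congr fun n => ?_
  simp

section

variable {Ω : Type*} [MeasurableSpace Ω] {P : Measure Ω} {X : ℕ → Ω → ℝ} {G : ℂ → ℂ}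

theorem tendsto_sum_latticeResidue (hX : IsRenewalSequence P X) (hR : 0 < expMomentBound P (X 0))
    (hG : IsMeromorphicExtension P (X 0) G) (hF : HasMesh (P.map (X 0)) 1) (k : ℕ) {r : ℕ → ℝ}
    (hr : Tendsto r atTop atTop) (hσ : Tendsto (fun n => latticeSup G (r n)) atTop (𝓝 0)) :
    Tendsto (fun n => ∑ᶠ z ∈ {z ∈ latticeRoots G \ {0} | z.re < r n}, latticeResidue G k z)
      atTop (𝓝 (remainder P X k : ℂ)) := by
  rw [tendsto_iff_norm_sub_tendsto_zero]
  have h2 : Tendsto (fun n => 2 * (latticeSup G (r n)).toReal) atTop (𝓝 0) := by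
    have := ((ENNReal.tendsto_toReal ENNReal.zero_ne_top).comp hσ).const_mul 2
    simpa using this
  refine squeeze_zero' (Eventually.of_forall fun n => norm_nonneg _) ?_ h2
  filter_upwards [hr.eventually_ge_atTop 1, hσ.eventually_lt_const ENNReal.zero_lt_top] with n h3 h4
  rw [norm_sub_rev]
  exact remainder_lattice hX hR hG hF k h3 h4.ne

theorem remainder_eq_finsum (hX : IsRenewalSequence P X) (hR : 0 < expMomentBound P (X 0))
    (hG : IsMeromorphicExtension P (X 0) G) (hF : HasMesh (P.map (X 0)) 1) (k : ℕ) {r : ℕ → ℝ}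
    (hr : Tendsto r atTop atTop) (hσ : Tendsto (fun n => latticeSup G (r n)) atTop (𝓝 0))
    (hfin : (latticeRoots G).Finite) :
    (remainder P X k : ℂ) = ∑ᶠ z ∈ latticeRoots G \ {0}, latticeResidue G k z := by
  refine tendsto_nhds_unique (tendsto_sum_latticeResidue hX hR hG hF k hr hσ)
    (tendsto_const_nhds.congr' ?_)
  have h : ∀ᶠ n in atTop, ∀ z ∈ latticeRoots G, z.re < r n :=
    (eventually_all_finite hfin).2 fun z _ => hr.eventually_gt_atTop z.re
  filter_upwards [h] with n hn
  have e : {z ∈ latticeRoots G \ {0} | z.re < r n} = latticeRoots G \ {0} :=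
    Set.sep_eq_self_iff_mem_true.2 fun z hz => hn z hz.1
  exact (congrArg (fun s : Set ℂ => ∑ᶠ z ∈ s, latticeResidue G k z) e).symm

/-- Ordering by real part makes each truncation Re z < r an initial segment of the enumeration, so
the contour sums are partial sums of the series. -/
theorem finsum_eq_sum_Icc (hX : IsRenewalSequence P X) (hR : 0 < expMomentBound P (X 0))
    (hG : IsMeromorphicExtension P (X 0) G) {z : ℕ → ℂ} (hz0 : z 0 = 0)
    (hinj : Function.Injective z) (hrange : Set.range z = latticeRoots G)
    (hmono : Monotone fun j => (z j).re) (F : ℂ → ℂ) (r : ℝ) :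
    ∃ N : ℕ, (∀ j, (z j).re < r → j ≤ N) ∧
      ∑ᶠ w ∈ {w ∈ latticeRoots G \ {0} | w.re < r}, F w = ∑ j ∈ Finset.Icc 1 N, F (z j) := by
  classical
  have hfin : {j | (z j).re < r}.Finite := by
    refine Set.Finite.of_finite_image ((finite_latticeRoots hX hR hG r).subset ?_) hinj.injOn
    rintro _ ⟨j, hj, rfl⟩
    exact ⟨hrange ▸ Set.mem_range_self j, hj⟩
  -- The index 0 is left out: if no root lies left of r, then N = 0, and the equivalence fails at j
  -- = 0 although the sum is correctly empty.
  obtain ⟨N, hN⟩ : ∃ N : ℕ, ∀ j, 1 ≤ j → ((z j).re < r ↔ j ≤ N) := by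
    by_cases hne : hfin.toFinset.Nonempty
    · refine ⟨hfin.toFinset.max' hne, fun j _ => ⟨fun hj =>
        Finset.le_max' _ _ (hfin.mem_toFinset.2 hj), fun hj => ?_⟩⟩
      exact (hmono hj).trans_lt (hfin.mem_toFinset.1 (Finset.max'_mem _ hne))
    · refine ⟨0, fun j hj1 => ⟨fun hj => absurd ⟨j, hfin.mem_toFinset.2 hj⟩ hne, by omega⟩⟩
  refine ⟨N, fun j hj => ?_, ?_⟩
  · rcases Nat.eq_zero_or_pos j with rfl | h
    · exact Nat.zero_le N
    · exact (hN j h).1 hj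
  · have hset : {w ∈ latticeRoots G \ {0} | w.re < r} = ((Finset.Icc 1 N).image z : Finset ℂ) := by
      ext w
      simp only [Finset.coe_image, Finset.coe_Icc, Set.mem_image, Set.mem_Icc]
      constructor
      · rintro ⟨⟨hw, hw0⟩, hwr⟩
        rw [← hrange] at hw
        obtain ⟨j, rfl⟩ := hw
        have hj : 1 ≤ j := Nat.one_le_iff_ne_zero.2 fun h => hw0 (by simp [h, hz0])
        exact ⟨j, ⟨hj, (hN j hj).1 hwr⟩, rfl⟩
      · rintro ⟨j, ⟨hj1, hj2⟩, rfl⟩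
        refine ⟨⟨hrange ▸ Set.mem_range_self j, fun h => ?_⟩, (hN j hj1).2 hj2⟩
        rw [Set.mem_singleton_iff, ← hz0] at h
        have := hinj h
        omega
    rw [hset, finsum_mem_coe_finset, Finset.sum_image hinj.injOn]

theorem remainder_eq_of_tendsto (hX : IsRenewalSequence P X) (hR : 0 < expMomentBound P (X 0))
    (hG : IsMeromorphicExtension P (X 0) G) (hF : HasMesh (P.map (X 0)) 1) (k : ℕ) {r : ℕ → ℝ}
    (hr : Tendsto r atTop atTop) (hσ : Tendsto (fun n => latticeSup G (r n)) atTop (𝓝 0))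
    {z : ℕ → ℂ} (hz0 : z 0 = 0) (hinj : Function.Injective z)
    (hrange : Set.range z = latticeRoots G) (hmono : Monotone fun j => (z j).re) {s : ℂ}
    (hs : Tendsto (fun n => ∑ j ∈ Finset.Icc 1 n, latticeResidue G k (z j)) atTop (𝓝 s)) :
    (remainder P X k : ℂ) = s := by
  choose N hN1 hN2 using fun n =>
    finsum_eq_sum_Icc hX hR hG hz0 hinj hrange hmono (latticeResidue G k) (r n)
  have hN : Tendsto N atTop atTop := tendsto_atTop.2 fun j => by
    filter_upwards [hr.eventually_gt_atTop (z j).re] with n hn using hN1 n j hn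
  have h1 := tendsto_sum_latticeResidue hX hR hG hF k hr hσ
  simp only [hN2] at h1
  exact tendsto_nhds_unique h1 (hs.comp hN)

end

/-! ### The non-lattice case: smoothing the renewal function -/

theorem norm_inv_sq_vertical (a θ : ℝ) :
    ‖(((a : ℂ) + θ * Complex.I) ^ 2)⁻¹‖ = (a ^ 2 + θ ^ 2)⁻¹ := by
  rw [norm_inv, norm_pow, ← Complex.normSq_eq_norm_sq, Complex.normSq_add_mul_I]

theorem vertical_ne_zero {a : ℝ} (ha : a ≠ 0) (θ : ℝ) : (a : ℂ) + θ * Complex.I ≠ 0 := fun h =>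
  ha (by simpa using congrArg Complex.re h)

theorem integrable_inv_sq_vertical {a : ℝ} (ha : a ≠ 0) :
    Integrable fun θ : ℝ => (((a : ℂ) + θ * Complex.I) ^ 2)⁻¹ := by
  refine (integrable_inv_one_add_sq.const_mul (min 1 (a ^ 2))⁻¹).mono'
    (Continuous.aestronglyMeasurable (Continuous.inv₀ (by fun_prop)
      fun θ => pow_ne_zero 2 (vertical_ne_zero ha θ))) (Eventually.of_forall fun θ => ?_)
  have h0 : 0 < min 1 (a ^ 2) := lt_min one_pos (by positivity)
  rw [norm_inv_sq_vertical, ← mul_inv]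
  refine inv_anti₀ (by positivity) ?_
  rw [mul_add]
  have h1 := min_le_left 1 (a ^ 2)
  have h2 := min_le_right 1 (a ^ 2)
  nlinarith [sq_nonneg θ]

theorem integrableOn_mul_exp {b : ℝ} (hb : b < 0) :
    IntegrableOn (fun t : ℝ => t * Real.exp (b * t)) (Set.Ioi 0) := by
  have := integrableOn_rpow_mul_exp_neg_mul_rpow (p := 1) (s := 1) (b := -b) (by norm_num)
    one_pos (by linarith)
  simpa using this

theorem integral_Ioi_mul_cexp {c : ℂ} (hc : c.re < 0) :
    ∫ t in Set.Ioi (0 : ℝ), (t : ℂ) * Complex.exp (c * t) = (c ^ 2)⁻¹ := by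
  have hc0 : c ≠ 0 := fun h => by simp [h] at hc
  have hnorm : ∀ t : ℝ, ‖Complex.exp (c * t)‖ = Real.exp (c.re * t) := fun t => by
    rw [Complex.norm_exp, Complex.re_mul_ofReal]
  have hint : IntegrableOn (fun t : ℝ => (t : ℂ) * Complex.exp (c * t)) (Set.Ioi 0) := by
    refine (integrableOn_mul_exp hc).mono' (Continuous.aestronglyMeasurable (by fun_prop)) ?_
    refine (ae_restrict_mem measurableSet_Ioi).mono fun t ht => ?_
    rw [norm_mul, hnorm, Complex.norm_real, Real.norm_eq_abs, abs_of_pos ht]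
  have hd : ∀ t ∈ Set.Ici (0 : ℝ), HasDerivAt
      (fun t : ℝ => ((t : ℂ) / c - (c ^ 2)⁻¹) * Complex.exp (c * t))
      ((t : ℂ) * Complex.exp (c * t)) t := fun t _ => by
    have h1 : HasDerivAt (fun t : ℝ => (t : ℂ)) 1 t := Complex.ofRealCLM.hasDerivAt
    have h2 := ((h1.div_const c).sub_const (c ^ 2)⁻¹).mul ((h1.const_mul c).cexp)
    convert! h2 using 1
    field_simp
    ring
  have hlim : Tendsto (fun t : ℝ => ((t : ℂ) / c - (c ^ 2)⁻¹) * Complex.exp (c * t)) atTop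
      (𝓝 0) := by
    have e1 : Tendsto (fun t : ℝ => t * Real.exp (c.re * t)) atTop (𝓝 0) := by
      have := Real.tendsto_pow_mul_exp_neg_atTop_nhds_zero 1
      have h := (this.comp (tendsto_id.const_mul_atTop (neg_pos.2 hc))).const_mul (-c.re)⁻¹
      rw [mul_zero] at h
      refine h.congr fun t => ?_
      have : c.re ≠ 0 := hc.ne
      simp only [Function.comp_apply, id, pow_one, neg_mul, neg_neg]
      field_simp
    have e2 : Tendsto (fun t : ℝ => Real.exp (c.re * t)) atTop (𝓝 0) :=
      Real.tendsto_exp_atBot.comp (tendsto_id.const_mul_atTop_of_neg hc)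
    have e3 : Tendsto (fun t : ℝ => (t : ℂ) * Complex.exp (c * t)) atTop (𝓝 0) := by
      refine squeeze_zero_norm' ?_ e1
      filter_upwards [eventually_ge_atTop 0] with t ht
      rw [norm_mul, hnorm, Complex.norm_real, Real.norm_eq_abs, abs_of_nonneg ht]
    have e4 : Tendsto (fun t : ℝ => Complex.exp (c * t)) atTop (𝓝 0) :=
      squeeze_zero_norm' (Eventually.of_forall fun t => (hnorm t).le) e2
    have h := (e3.const_mul c⁻¹).sub (e4.const_mul (c ^ 2)⁻¹)
    simp only [mul_zero, sub_zero] at h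
    refine h.congr fun t => ?_
    rw [div_eq_inv_mul]; ring
  rw [integral_Ioi_of_hasDerivAt_of_tendsto' hd hint hlim]
  simp

open FourierTransform in
/-- The Laplace inversion formula for the positive part. -/
theorem integral_cexp_div_sq {a : ℝ} (ha : a < 0) (u : ℝ) :
    ∫ θ : ℝ, Complex.exp (-(u * (a + θ * Complex.I))) / (a + θ * Complex.I) ^ 2
      = 2 * Real.pi * (max u 0 : ℝ) := by
  -- The damped positive part t₊ e^{at} is continuous and integrable, with integrable Fourier
  -- transform 1/(a + iθ)² at θ = -2πξ, so Fourier inversion holds at every point.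
  set f : ℝ → ℂ := fun t => ((max t 0 * Real.exp (a * t) : ℝ) : ℂ) with hf
  have hfc : Continuous f := by fun_prop
  have hf0 : ∀ t, t ∉ Set.Ioi (0 : ℝ) → f t = 0 := fun t ht => by
    simp [hf, max_eq_right (not_lt.1 (Set.mem_Ioi.not.1 ht))]
  have hfi : Integrable f := by
    rw [← integrableOn_iff_integrable_of_support_subset (s := Set.Ioi 0)
      (fun t ht => by_contra fun h => ht (hf0 t h))]
    refine ((integrableOn_mul_exp ha).ofReal (𝕜 := ℂ)).congr ?_
    refine (ae_restrict_mem measurableSet_Ioi).mono fun t ht => ?_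
    simp [hf, max_eq_left (le_of_lt (Set.mem_Ioi.1 ht))]
  have hF : 𝓕 f = fun ξ : ℝ => (((a : ℂ) + (-2 * Real.pi * ξ : ℝ) * Complex.I) ^ 2)⁻¹ := by
    funext ξ
    rw [Real.fourier_real_eq_integral_exp_smul, ← integral_Ioi_mul_cexp (by simpa using ha),
      ← setIntegral_eq_integral_of_forall_compl_eq_zero (s := Set.Ioi 0)
        (fun t ht => by rw [hf0 t ht, smul_zero])]
    refine setIntegral_congr_fun measurableSet_Ioi fun t ht => ?_
    simp only [hf, max_eq_left (le_of_lt (Set.mem_Ioi.1 ht)), smul_eq_mul]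
    push_cast
    rw [mul_left_comm, ← Complex.exp_add]
    ring_nf
  have hpi : (-2 * Real.pi : ℝ) ≠ 0 := by simp [Real.pi_ne_zero]
  have hFi : Integrable (𝓕 f) := by
    rw [hF]
    exact (integrable_inv_sq_vertical ha.ne).comp_mul_left' hpi
  have key := hfi.fourierInv_fourier_eq hFi (hfc.continuousAt (x := u))
  rw [Real.fourierInv_eq', hF] at key
  have h2 := Measure.integral_comp_mul_left (fun θ : ℝ =>
    Complex.exp (-(u * θ * Complex.I)) / (a + θ * Complex.I) ^ 2) (-2 * Real.pi)
  have h3 : ∫ θ : ℝ, Complex.exp (-(u * θ * Complex.I)) / (a + θ * Complex.I) ^ 2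
      = 2 * Real.pi * f u := by
    have e : |(-2 * Real.pi)⁻¹| = (2 * Real.pi)⁻¹ := by
      rw [abs_inv, neg_mul, abs_neg, abs_of_pos (by positivity)]
    rw [e] at h2
    have h4 : (fun ξ : ℝ => Complex.exp (-(u * ((-2 * Real.pi * ξ : ℝ) : ℂ) * Complex.I)) /
        (a + ((-2 * Real.pi * ξ : ℝ) : ℂ) * Complex.I) ^ 2) = fun v : ℝ =>
        Complex.exp (((2 * Real.pi * inner ℝ v u : ℝ) : ℂ) * Complex.I) •
          (((a : ℂ) + (-2 * Real.pi * v : ℝ) * Complex.I) ^ 2)⁻¹ := by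
      funext v
      rw [smul_eq_mul, div_eq_mul_inv]
      congr 2
      simp
      ring
    rw [h4, key, Complex.real_smul] at h2
    have hpi' : (Real.pi : ℂ) ≠ 0 := by exact_mod_cast Real.pi_ne_zero
    have h6 : 2 * (Real.pi : ℂ) * (((2 * Real.pi)⁻¹ : ℝ) : ℂ) = 1 := by
      push_cast
      field_simp
    rw [h2, ← mul_assoc, h6, one_mul]
  have h5 : ∀ θ : ℝ, Complex.exp (-(u * (a + θ * Complex.I))) / (a + θ * Complex.I) ^ 2
      = Complex.exp (-(u * a)) *
        (Complex.exp (-(u * θ * Complex.I)) / (a + θ * Complex.I) ^ 2) := fun θ => by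
    rw [← mul_div_assoc, ← Complex.exp_add]
    ring_nf
  simp only [h5]
  rw [integral_const_mul, h3, hf]
  simp only
  push_cast
  have : Complex.exp (-(u * a)) * Complex.exp (a * u) = 1 := by
    rw [← Complex.exp_add]; ring_nf; simp
  linear_combination (2 * (Real.pi : ℂ) * (max u 0 : ℝ)) * this

/-- The continuous function equal to `1` on `(-∞, x]`, to `0` on `[x + δ, ∞)` and affine between. -/
noncomputable def ramp (x δ s : ℝ) : ℝ := (max (x + δ - s) 0 - max (x - s) 0) / δ

theorem ramp_of_le {x δ s : ℝ} (hδ : 0 < δ) (hs : s ≤ x) : ramp x δ s = 1 := by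
  rw [ramp, max_eq_left (by linarith), max_eq_left (by linarith), div_eq_one_iff_eq hδ.ne']
  ring

theorem ramp_of_ge {x δ s : ℝ} (hδ : 0 < δ) (hs : x + δ ≤ s) : ramp x δ s = 0 := by
  rw [ramp, max_eq_right (by linarith), max_eq_right (by linarith)]
  simp

theorem ramp_nonneg {x δ : ℝ} (hδ : 0 < δ) (s : ℝ) : 0 ≤ ramp x δ s :=
  div_nonneg (sub_nonneg.2 (max_le_max_right 0 (by linarith))) hδ.le

theorem ramp_le_one {x δ : ℝ} (hδ : 0 < δ) (s : ℝ) : ramp x δ s ≤ 1 := by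
  rw [ramp, div_le_one hδ, sub_le_iff_le_add]
  refine max_le ?_ (add_nonneg hδ.le (le_max_right _ _))
  linarith [le_max_left (x - s) 0]

theorem continuous_ramp (x δ : ℝ) : Continuous (ramp x δ) := by
  unfold ramp; fun_prop

theorem tendsto_ramp (x s : ℝ) :
    Tendsto (fun δ => ramp x δ s) (𝓝[>] 0) (𝓝 ((Set.Iic x).indicator 1 s)) := by
  by_cases hs : s ≤ x
  · rw [Set.indicator_of_mem (Set.mem_Iic.2 hs)]
    refine tendsto_const_nhds.congr' ?_
    filter_upwards [self_mem_nhdsWithin] with δ hδ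
    rw [ramp_of_le hδ hs]; rfl
  · rw [Set.indicator_of_notMem (by simpa using hs)]
    refine tendsto_const_nhds.congr' ?_
    filter_upwards [Ioo_mem_nhdsGT (sub_pos.2 (not_le.1 hs))] with δ hδ
    rw [ramp_of_ge hδ.1 (by linarith [hδ.2])]

/-- The kernel of the Laplace inversion formula for `ramp x δ`. -/
noncomputable def rampKernel (x δ : ℝ) (z : ℂ) : ℂ :=
  (Complex.exp (-((x + δ : ℝ) * z)) - Complex.exp (-(x * z))) / δ

theorem differentiable_rampKernel (x δ : ℝ) : Differentiable ℂ (rampKernel x δ) := by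
  unfold rampKernel; fun_prop

theorem norm_rampKernel_le {x δ a : ℝ} (hx : 0 ≤ x) (hδ : 0 < δ) {z : ℂ} (hz : a ≤ z.re) :
    ‖rampKernel x δ z‖ ≤ (Real.exp (-((x + δ) * a)) + Real.exp (-(x * a))) / δ := by
  rw [rampKernel, norm_div, Complex.norm_real, Real.norm_eq_abs, abs_of_pos hδ]
  gcongr
  refine (norm_sub_le _ _).trans ?_
  rw [Complex.norm_exp, Complex.norm_exp, Complex.neg_re, Complex.neg_re, Complex.re_ofReal_mul,
    Complex.re_ofReal_mul]
  gcongr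

theorem integrable_cexp_div_sq {a : ℝ} (ha : a ≠ 0) (u : ℝ) : Integrable fun θ : ℝ =>
    Complex.exp (-(u * (a + θ * Complex.I))) / (a + θ * Complex.I) ^ 2 := by
  simp only [div_eq_mul_inv]
  refine (integrable_inv_sq_vertical ha).bdd_mul (c := Real.exp (-(u * a)))
    (Continuous.aestronglyMeasurable (by fun_prop)) (Eventually.of_forall fun θ => ?_)
  rw [Complex.norm_exp]
  simp

/-- The ramp is a difference of two translated positive parts divided by δ, and the inversion
formula is linear. -/
theorem integral_rampKernel {a δ : ℝ} (ha : a < 0) (x s : ℝ) :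
    ∫ θ : ℝ, rampKernel x δ (a + θ * Complex.I) / (a + θ * Complex.I) ^ 2 *
      Complex.exp ((a + θ * Complex.I) * s) = 2 * Real.pi * (ramp x δ s : ℝ) := by
  have h1 := integral_cexp_div_sq ha (x + δ - s)
  have h2 := integral_cexp_div_sq ha (x - s)
  have e : ∀ θ : ℝ, rampKernel x δ (a + θ * Complex.I) / (a + θ * Complex.I) ^ 2 *
      Complex.exp ((a + θ * Complex.I) * s) = (δ : ℂ)⁻¹ *
      (Complex.exp (-((x + δ - s : ℝ) * (a + θ * Complex.I))) / (a + θ * Complex.I) ^ 2 -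
        Complex.exp (-((x - s : ℝ) * (a + θ * Complex.I))) / (a + θ * Complex.I) ^ 2) := by
    intro θ
    have e1 : Complex.exp (-((x + δ - s : ℝ) * (a + θ * Complex.I))) =
        Complex.exp (-((x + δ : ℝ) * (a + θ * Complex.I))) *
          Complex.exp ((a + θ * Complex.I) * s) := by
      rw [← Complex.exp_add]; push_cast; ring_nf
    have e2 : Complex.exp (-((x - s : ℝ) * (a + θ * Complex.I))) =
        Complex.exp (-(x * (a + θ * Complex.I))) * Complex.exp ((a + θ * Complex.I) * s) := by
      rw [← Complex.exp_add]; push_cast; ring_nf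
    rw [e1, e2, rampKernel]
    ring
  simp only [e]
  rw [integral_const_mul, integral_sub (integrable_cexp_div_sq ha.ne _)
    (integrable_cexp_div_sq ha.ne _), h1, h2, ramp]
  push_cast
  ring

/-! ### Non-lattice case: shifting the contour -/

section

variable {Ω : Type*} [MeasurableSpace Ω] {P : Measure Ω} {X : ℕ → Ω → ℝ} {G : ℂ → ℂ}

/-- The average of the renewal function over `[x, x + δ]`. -/
noncomputable def smoothedRenewal (P : Measure Ω) (X : ℕ → Ω → ℝ) (x δ : ℝ) : ℝ :=
  ∑' n, ∫ ω, ramp x δ (arrivalTime X n ω) ∂P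

/-- Dominated convergence twice, in ω and then in n: for δ < 1 the ramp is at most the indicator of
s ≤ x + 1, and P(S_n ≤ x + 1) is summable. Smoothing to the right of x gives the limit U(x) itself.
-/
theorem IsRenewalSequence.tendsto_smoothedRenewal (hX : IsRenewalSequence P X) (x : ℝ) :
    Tendsto (smoothedRenewal P X x) (𝓝[>] 0) (𝓝 (renewalFunction P X x)) := by
  have := hX.isProbabilityMeasure
  have hm : ∀ n y, NullMeasurableSet {ω | arrivalTime X n ω ≤ y} P := fun n y =>
    nullMeasurableSet_le (hX.aemeasurable_arrivalTime n) aemeasurable_const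
  have hint : ∀ n y, ∫ ω, (Set.Iic y).indicator (1 : ℝ → ℝ) (arrivalTime X n ω) ∂P
      = P.real {ω | arrivalTime X n ω ≤ y} := fun n y => by
    have h := integral_indicator₀ (μ := P) (f := fun _ => (1 : ℝ)) (hm n y)
    rw [setIntegral_const, smul_eq_mul, mul_one] at h
    rw [← h]; rfl
  have hI : ∀ n y, Integrable (fun ω => (Set.Iic y).indicator (1 : ℝ → ℝ) (arrivalTime X n ω)) P :=
    fun n y => (integrable_const (1 : ℝ)).indicator₀ (hm n y)
  rw [hX.renewalFunction_eq]
  refine tendsto_tsum_of_dominated_convergence (hX.summable_measureReal (x + 1)) (fun n => ?_) ?_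
  · rw [← hint]
    refine tendsto_integral_filter_of_dominated_convergence (fun _ => 1) ?_ ?_
      (integrable_const _) (Eventually.of_forall fun ω => tendsto_ramp x _)
    · exact Eventually.of_forall fun δ => ((continuous_ramp x δ).measurable.comp_aemeasurable
        (hX.aemeasurable_arrivalTime n)).aestronglyMeasurable
    · filter_upwards [self_mem_nhdsWithin] with δ hδ
      refine Eventually.of_forall fun ω => ?_
      rw [Real.norm_eq_abs, abs_of_nonneg (ramp_nonneg hδ _)]
      exact ramp_le_one hδ _
  · filter_upwards [Ioo_mem_nhdsGT one_pos] with δ hδ n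
    rw [← hint]
    refine norm_integral_le_of_norm_le (hI n _) (Eventually.of_forall fun ω => ?_)
    rw [Real.norm_eq_abs, abs_of_nonneg (ramp_nonneg hδ.1 _)]
    by_cases h : arrivalTime X n ω ≤ x + 1
    · rw [Set.indicator_of_mem (Set.mem_Iic.2 h)]
      exact ramp_le_one hδ.1 _
    · rw [Set.indicator_of_notMem (by simpa using h), ramp_of_ge hδ.1 (by linarith [hδ.2])]

theorem integrable_vertical (hG : MeromorphicNFOn G Set.univ) {x δ c B : ℝ} (hx : 0 ≤ x)
    (hδ : 0 < δ) (hc : c ≠ 0)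
    (h : ∀ θ : ℝ, G (c + θ * Complex.I) ≠ 1 ∧ ‖recipExt G (c + θ * Complex.I)‖ ≤ B) :
    Integrable fun θ : ℝ => rampKernel x δ (c + θ * Complex.I) / (c + θ * Complex.I) ^ 2 *
      recipExt G (c + θ * Complex.I) := by
  have e : (fun θ : ℝ => rampKernel x δ (c + θ * Complex.I) / (c + θ * Complex.I) ^ 2 *
      recipExt G (c + θ * Complex.I)) = fun θ : ℝ => (rampKernel x δ (c + θ * Complex.I) *
        recipExt G (c + θ * Complex.I)) * ((c + θ * Complex.I) ^ 2)⁻¹ := by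
    funext θ; ring
  rw [e]
  refine (integrable_inv_sq_vertical hc).bdd_mul
    (c := (Real.exp (-((x + δ) * c)) + Real.exp (-(x * c))) / δ * B)
    (Continuous.aestronglyMeasurable ?_) (Eventually.of_forall fun θ => ?_)
  · refine Continuous.mul ((differentiable_rampKernel x δ).continuous.comp (by fun_prop)) ?_
    rw [continuous_iff_continuousAt]
    intro θ
    exact ContinuousAt.comp (f := fun θ : ℝ => (c : ℂ) + θ * Complex.I)
      (differentiableAt_recipExt (hG (Set.mem_univ _)) (h θ).1).continuousAt (by fun_prop)
  · rw [norm_mul]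
    gcongr
    · exact norm_rampKernel_le hx hδ (by simp)
    · exact (h θ).2

/-- For c ≥ 1, 1/(c² + θ²) ≤ 1/(1 + θ²), whose integral is π. The decay e^{-xc} is kept to absorb a
factor c hidden in B later. -/
theorem norm_integral_vertical_le {x δ c B : ℝ} (hx : 0 ≤ x)
    (hδ : 0 < δ) (hc : 1 ≤ c) (hB : ∀ θ : ℝ, ‖recipExt G (c + θ * Complex.I)‖ ≤ B) :
    ‖∫ θ : ℝ, rampKernel x δ (c + θ * Complex.I) / (c + θ * Complex.I) ^ 2 *
      recipExt G (c + θ * Complex.I)‖ ≤ 2 * Real.exp (-(x * c)) / δ * B * Real.pi := by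
  have hB0 : 0 ≤ B := (norm_nonneg _).trans (hB 0)
  rw [← integral_univ_inv_one_add_sq, ← integral_const_mul]
  refine norm_integral_le_of_norm_le (integrable_inv_one_add_sq.const_mul _)
    (Eventually.of_forall fun θ => ?_)
  rw [norm_mul, div_eq_mul_inv (rampKernel _ _ _), norm_mul, norm_inv_sq_vertical,
    mul_right_comm]
  have h1 : ‖rampKernel x δ (c + θ * Complex.I)‖ ≤ 2 * Real.exp (-(x * c)) / δ := by
    refine (norm_rampKernel_le (a := c) hx hδ (by simp)).trans ?_
    gcongr
    rw [two_mul]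
    gcongr
    linarith
  have h2 : (c ^ 2 + θ ^ 2)⁻¹ ≤ (1 + θ ^ 2)⁻¹ := inv_anti₀ (by positivity) (by nlinarith)
  have := hB θ
  gcongr

theorem integral_eq_smoothedRenewal (hX : IsRenewalSequence P X)
    (hR : 0 < expMomentBound P (X 0)) (hG : IsMeromorphicExtension P (X 0) G) {x δ a : ℝ}
    (ha : a < 0) :
    ∫ θ : ℝ, rampKernel x δ (a + θ * Complex.I) / (a + θ * Complex.I) ^ 2 *
      recipExt G (a + θ * Complex.I) = 2 * Real.pi * (smoothedRenewal P X x δ : ℂ) := by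
  have hk : Integrable fun θ : ℝ => rampKernel x δ (a + θ * Complex.I) /
      (a + θ * Complex.I) ^ 2 := by
    have := ((integrable_cexp_div_sq ha.ne (x + δ)).sub (integrable_cexp_div_sq ha.ne x)).div_const
      (δ : ℂ)
    refine this.congr (Eventually.of_forall fun θ => ?_)
    simp only [rampKernel, Pi.sub_apply]
    ring
  have key := hX.hasSum_integral hR ha hk (Ψ := fun s => 2 * Real.pi * (ramp x δ s : ℝ))
    fun n => Eventually.of_forall fun ω => (integral_rampKernel ha x _).symm
  have e : ∀ n, ∫ ω, 2 * (Real.pi : ℂ) * (ramp x δ (arrivalTime X n ω) : ℝ) ∂P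
      = 2 * Real.pi * ((∫ ω, ramp x δ (arrivalTime X n ω) ∂P : ℝ) : ℂ) := fun n => by
    rw [integral_const_mul, integral_complex_ofReal]
  simp only [e] at key
  rw [smoothedRenewal, Complex.ofReal_tsum, ← tsum_mul_left, key.tsum_eq]
  refine integral_congr_ae (Eventually.of_forall fun θ => ?_)
  have hre : ((a : ℂ) + θ * Complex.I).re ≤ 0 := by simpa using ha.le
  have hGa := hG.analyticAt (hX.meas 0) (hX.nonneg 0) (z := a + θ * Complex.I)
    (IsMeromorphicExtension.lt_of_re_nonpos hR hre)
  simp only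
  rw [(recipExt_eventuallyEq_nhds hGa).eq_of_nhds, hG.eq_of_re_nonpos hR hre]

theorem nonLatticeSup_bound (hG : MeromorphicNFOn G Set.univ) {r : ℝ} (hr0 : 0 < r)
    (hr : nonLatticeSup G r ≠ ⊤) (θ : ℝ) : G (r + θ * Complex.I) ≠ 1 ∧
      ‖recipExt G (r + θ * Complex.I)‖ ≤ (nonLatticeSup G r).toReal * r := by
  have h1 : absRecip G (r + θ * Complex.I) ≤ nonLatticeSup G r * ENNReal.ofReal r :=
    (ENNReal.div_le_iff (by simpa using hr0) ENNReal.ofReal_ne_top).1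
      (le_iSup (fun θ : ℝ => absRecip G (r + θ * Complex.I) / ENNReal.ofReal r) θ)
  have := norm_recipExt_le (ENNReal.mul_ne_top hr ENNReal.ofReal_ne_top) (hG (Set.mem_univ _)) h1
  rwa [ENNReal.toReal_mul, ENNReal.toReal_ofReal hr0.le] at this

theorem ConditionA.exists_bound {R₀ : ℝ} (h : ConditionA G R₀) (hG : MeromorphicNFOn G Set.univ) :
    ∃ C T : ℝ, 0 < C ∧ ∀ s ∈ Set.Icc 0 R₀, ∀ θ : ℝ, T ≤ |θ| →
      G (s + θ * Complex.I) ≠ 1 ∧ ‖recipExt G (s + θ * Complex.I)‖ ≤ C := by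
  obtain ⟨C, hC1, hC2⟩ := exists_between h
  have hev := eventually_lt_of_limsup_lt hC1 (by isBoundedDefault)
  rw [eventually_sup] at hev
  obtain ⟨T1, hT1⟩ := eventually_atBot.1 hev.1
  obtain ⟨T2, hT2⟩ := eventually_atTop.1 hev.2
  refine ⟨C.toReal + 1, max (-T1) T2, by positivity, fun s hs θ hθ => ?_⟩
  have h3 : ⨆ r ∈ Set.Icc 0 R₀, absRecip G (r + θ * Complex.I) < C := by
    rcases le_abs.1 hθ with h | h
    · exact hT2 θ ((le_max_right _ _).trans h)
    · exact hT1 θ (by linarith [le_max_left (-T1) T2])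
  have h4 := norm_recipExt_le hC2.ne (hG (Set.mem_univ _))
    ((le_iSup₂ (f := fun (r : ℝ) (_ : r ∈ Set.Icc 0 R₀) => absRecip G (r + θ * Complex.I)) s
      hs).trans h3.le)
  exact ⟨h4.1, h4.2.trans (by linarith)⟩

/-- Condition (A) starts at Re z = 0, whereas the contour starts to the left of it. On the imaginary
axis |1 - G| ≥ 1/C₁ for large |θ|, and moving left by at most 1/(2C₁μ) costs at most half of that.
The width depends on C₁ alone, so a does not depend on r. -/
theorem exists_strip_bound (hX : IsRenewalSequence P X) (hR : 0 < expMomentBound P (X 0))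
    (hG : IsMeromorphicExtension P (X 0) G) (hA : ∀ R₀ : ℝ, 0 < R₀ → ConditionA G R₀) :
    ∃ a < 0, ∀ r : ℝ, 0 < r → ∃ C T : ℝ, ∀ s ∈ Set.Icc a r, ∀ θ : ℝ, T ≤ |θ| →
      ‖recipExt G (s + θ * Complex.I)‖ ≤ C := by
  have := hX.isProbabilityMeasure
  obtain ⟨C₁, T₁, hC₁, h₁⟩ := (hA 1 one_pos).exists_bound hG.meromorphic
  have hμ := integral_pos_of_not_ae_zero (hX.nonneg 0) (IsMeromorphicExtension.integrable
    (hX.meas 0) (hX.nonneg 0) hR) hX.ne_zero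
  set m := ∫ ω, X 0 ω ∂P with hm
  refine ⟨-(2 * C₁ * m)⁻¹, by simp; positivity, fun r hr => ?_⟩
  obtain ⟨C₂, T₂, hC₂, h₂⟩ := (hA r hr).exists_bound hG.meromorphic
  refine ⟨max (2 * C₁) C₂, max T₁ T₂, fun s hs θ hθ => ?_⟩
  rcases le_total 0 s with h0 | h0
  · exact (h₂ s ⟨h0, hs.2⟩ θ ((le_max_right _ _).trans hθ)).2.trans (le_max_right _ _)
  · refine le_trans ?_ (le_max_left _ _)
    have h3 := h₁ 0 (by simp) θ ((le_max_left _ _).trans hθ)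
    rw [Complex.ofReal_zero, zero_add] at h3
    have h4 := hG.norm_sub_le (hX.meas 0) (hX.nonneg 0) hR (θ := θ) h0
    have han : ∀ s : ℝ, s ≤ 0 → recipExt G (s + θ * Complex.I)
        = (1 - G (s + θ * Complex.I))⁻¹ := fun s hs => by
      have hGa := hG.analyticAt (hX.meas 0) (hX.nonneg 0) (z := s + θ * Complex.I)
        (IsMeromorphicExtension.lt_of_re_nonpos hR (by simpa using hs))
      exact (recipExt_eventuallyEq_nhds hGa).eq_of_nhds
    have e0 := han 0 le_rfl
    rw [Complex.ofReal_zero, zero_add] at e0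
    rw [e0, norm_inv, inv_le_comm₀ (norm_pos_iff.2 (sub_ne_zero.2 h3.1.symm)) hC₁] at h3
    rw [han s h0, norm_inv]
    have h5 : -s * m ≤ (2 * C₁)⁻¹ := by
      have : -s ≤ (2 * C₁ * m)⁻¹ := by linarith [hs.1]
      calc -s * m ≤ (2 * C₁ * m)⁻¹ * m := by gcongr
        _ = _ := by field_simp
    have h6 : ‖1 - G (θ * Complex.I)‖ ≤ ‖1 - G (s + θ * Complex.I)‖ +
        ‖G (s + θ * Complex.I) - G (θ * Complex.I)‖ := by
      refine le_trans (le_of_eq ?_) (norm_add_le _ _)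
      congr 1; ring
    have h7 : (2 * C₁)⁻¹ ≤ ‖1 - G (s + θ * Complex.I)‖ := by
      have h8 : C₁⁻¹ = (2 * C₁)⁻¹ + (2 * C₁)⁻¹ := by field_simp; norm_num
      linarith [h3.2]
    exact (inv_le_comm₀ (lt_of_lt_of_le (by positivity) h7) (by positivity)).2 h7

theorem tendsto_integral_horizontal {f : ℂ → ℂ} {a r B : ℝ} {l : ℝ → ℝ}
    (hl : Tendsto (fun T => |l T|) atTop atTop)
    (hf : ∀ᶠ T in atTop, ∀ x ∈ Set.uIoc a r, ‖f (x + l T * Complex.I)‖ ≤ B / l T ^ 2) :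
    Tendsto (fun T => ∫ x in a..r, f (x + l T * Complex.I)) atTop (𝓝 0) := by
  have h1 : Tendsto (fun T => B / l T ^ 2 * |r - a|) atTop (𝓝 0) := by
    have h2 : Tendsto (fun T => l T ^ 2) atTop atTop := by
      simpa [Function.comp_def] using (tendsto_pow_atTop two_ne_zero).comp hl
    simpa using (h2.const_div_atTop B).mul_const |r - a|
  refine squeeze_zero_norm' ?_ h1
  filter_upwards [hf] with T hT
  exact intervalIntegral.norm_integral_le_of_norm_le_const hT

/-- Shifting the contour of the inversion integral from `Re z = a` to `Re z = r`. -/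
theorem integral_vertical_sub (hX : IsRenewalSequence P X)
    (hR : 0 < expMomentBound P (X 0)) (hG : IsMeromorphicExtension P (X 0) G)
    {x δ a r B B' C T₀ : ℝ} (hx : 0 ≤ x) (hδ : 0 < δ) (ha : a < 0) (hr : 0 < r)
    (hra : ∀ θ : ℝ, G (a + θ * Complex.I) ≠ 1 ∧ ‖recipExt G (a + θ * Complex.I)‖ ≤ B)
    (hrr : ∀ θ : ℝ, G (r + θ * Complex.I) ≠ 1 ∧ ‖recipExt G (r + θ * Complex.I)‖ ≤ B')
    (hC : ∀ s ∈ Set.Icc a r, ∀ θ : ℝ, T₀ ≤ |θ| → ‖recipExt G (s + θ * Complex.I)‖ ≤ C)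
    (hreal : ∀ w, G w = 1 → w.im = 0) {S : Finset ℂ} (hS : ∀ w, w ∈ S ↔ G w = 1 ∧ w.re < r) :
    (∫ θ : ℝ, rampKernel x δ (r + θ * Complex.I) / (r + θ * Complex.I) ^ 2 *
        recipExt G (r + θ * Complex.I)) -
      (∫ θ : ℝ, rampKernel x δ (a + θ * Complex.I) / (a + θ * Complex.I) ^ 2 *
        recipExt G (a + θ * Complex.I))
      = 2 * Real.pi * ∑ s ∈ S, residue (fun z => rampKernel x δ z / z ^ 2 * recipExt G z) s := by
  have := hX.isProbabilityMeasure
  set f : ℂ → ℂ := fun z => rampKernel x δ z / z ^ 2 * recipExt G z with hf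
  -- All roots are real, so every T > 0 encloses the same ones and the residue sum does not depend
  -- on T.
  have hrect : ∀ T : ℝ, 0 < T →
      rectIntegral f a r (-T) T = 2 * Real.pi * Complex.I * ∑ s ∈ S, residue f s := by
    intro T hT
    refine rectIntegral_eq_sum_residue (by linarith) (by linarith) S f (fun s hs => ?_)
      (fun s _ => ?_) (fun z hz hzS => ?_)
    · obtain ⟨h1, h2⟩ := (hS s).1 hs
      have h3 := hG.re_nonneg_of_eq_one (hX.meas 0) (hX.nonneg 0) hX.ne_zero hR h1
      have h4 := hreal s h1
      exact ⟨⟨by linarith, h2⟩, by rw [h4]; simpa using hT, by rw [h4]; exact hT⟩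
    · have h1 : AnalyticAt ℂ (rampKernel x δ) s :=
        (differentiable_rampKernel x δ).analyticAt s
      exact (h1.meromorphicAt.div ((MeromorphicAt.id s).pow 2)).mul
        (meromorphicAt_recipExt (hG.meromorphic (Set.mem_univ s)).meromorphicAt)
    -- The factor 1/z² brings no further singular point, since 0 is itself a root.
    · have h0 : z ≠ 0 := fun h => hzS ((hS z).2 (by rw [h]; exact ⟨hG.apply_zero hR, hr⟩))
      have h1 : G z ≠ 1 := fun h => by
        refine hzS ((hS z).2 ⟨h, hz.1.2.lt_of_ne fun h2 => ?_⟩)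
        refine (hrr z.im).1 ?_
        rw [← h2, Complex.re_add_im]
        exact h
      have h2 : DifferentiableAt ℂ (fun z : ℂ => z ^ 2) z := by fun_prop
      exact ((differentiable_rampKernel x δ z).fun_div h2 (pow_ne_zero 2 h0)).fun_mul
        (differentiableAt_recipExt (hG.meromorphic (Set.mem_univ z)) h1)
  have hbd : ∀ θ : ℝ, 0 < |θ| → T₀ ≤ |θ| → ∀ s ∈ Set.uIoc a r, ‖f (s + θ * Complex.I)‖ ≤
      (Real.exp (-((x + δ) * a)) + Real.exp (-(x * a))) / δ * C / θ ^ 2 := by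
    intro θ hθ0 hθ s hs
    rw [Set.uIoc_of_le (by linarith)] at hs
    have h1 := hC s ⟨hs.1.le, hs.2⟩ θ hθ
    have h2 := norm_rampKernel_le (a := a) (z := s + θ * Complex.I) hx hδ (by simpa using hs.1.le)
    have h3 : (s ^ 2 + θ ^ 2)⁻¹ ≤ (θ ^ 2)⁻¹ :=
      inv_anti₀ (by rw [← sq_abs]; positivity) (by nlinarith)
    have hC0 : 0 ≤ C := (norm_nonneg _).trans h1
    rw [hf]
    simp only
    rw [norm_mul, div_eq_mul_inv (rampKernel _ _ _), norm_mul, norm_inv_sq_vertical,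
      mul_right_comm, div_eq_mul_inv _ (θ ^ 2)]
    gcongr
  have hev : ∀ᶠ T : ℝ in atTop, 0 < |T| ∧ T₀ ≤ |T| :=
    (tendsto_abs_atTop_atTop.eventually_gt_atTop 0).and
      (tendsto_abs_atTop_atTop.eventually_ge_atTop T₀)
  have h1 : Tendsto (fun T : ℝ => ∫ y in a..r, f (y + (-T : ℝ) * Complex.I)) atTop (𝓝 0) :=
    tendsto_integral_horizontal (by simpa using tendsto_abs_atTop_atTop)
      (hev.mono fun T hT => hbd (-T) (by simpa using hT.1) (by simpa using hT.2))
  have h2 : Tendsto (fun T : ℝ => ∫ y in a..r, f (y + T * Complex.I)) atTop (𝓝 0) :=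
    tendsto_integral_horizontal (l := fun T => T) tendsto_abs_atTop_atTop
      (hev.mono fun T hT => hbd T hT.1 hT.2)
  have h3 := intervalIntegral_tendsto_integral
    (integrable_vertical hG.meromorphic hx hδ hr.ne' hrr) tendsto_neg_atTop_atBot tendsto_id
  have h4 := intervalIntegral_tendsto_integral
    (integrable_vertical hG.meromorphic hx hδ ha.ne hra) tendsto_neg_atTop_atBot tendsto_id
  have h5 : Tendsto (fun T => rectIntegral f a r (-T) T) atTop _ :=
    ((h1.sub h2).add (h3.const_mul Complex.I)).sub (h4.const_mul Complex.I)
  have h6 : Tendsto (fun T => rectIntegral f a r (-T) T) atTop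
      (𝓝 (2 * Real.pi * Complex.I * ∑ s ∈ S, residue f s)) :=
    tendsto_const_nhds.congr' (by
      filter_upwards [eventually_gt_atTop 0] with T hT
      exact (hrect T hT).symm)
  have h7 := tendsto_nhds_unique h5 h6
  refine mul_left_cancel₀ Complex.I_ne_zero ?_
  linear_combination h7

/-- The residue of `φ / (1 - G)` at a simple solution of `G = 1`. -/
theorem residue_simple_root {f φ : ℂ → ℂ} {s : ℂ} (hGs : MeromorphicNFAt G s) (h1 : G s = 1)
    (h' : deriv G s ≠ 0) (hφ : AnalyticAt ℂ φ s) (hf : ∀ᶠ z in 𝓝[≠] s, f z = φ z * (1 - G z)⁻¹) :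
    residue f s = -(φ s / deriv G s) := by
  obtain ⟨B, hB, eB, B0, -⟩ := exists_eq_add_mul (analyticAt_of_eq_one hGs h1)
  have hB0 : B s ≠ 0 := by rwa [B0]
  rw [residue_of_simple_pole (F := fun z => -(φ z / B z)) (hφ.div hB hB0).neg, B0]
  filter_upwards [hf] with z hz
  rw [hz, eB z, h1]
  simp only [div_eq_mul_inv, sub_add_cancel_left, inv_neg, mul_inv]
  ring

/-! ### Non-lattice case: residues of the smoothed integrand -/

theorem nonLatticeResidue_eq (hG : MeromorphicNFOn G Set.univ) (x : ℝ) {s : ℂ} (hs : s ≠ 0)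
    (h1 : G s = 1) (h' : deriv G s ≠ 0) :
    nonLatticeResidue G x s = -(Complex.exp (-(x * s)) / (s * deriv G s)) := by
  rw [nonLatticeResidue, residue_simple_root (φ := fun z => Complex.exp (-(x * z)) / z)
    (hG (Set.mem_univ s)) h1 h' (AnalyticAt.div (by fun_prop) analyticAt_id hs), div_div]
  refine Eventually.of_forall fun z => ?_
  rw [← div_div, div_eq_mul_inv _ (1 - G z)]

/-- The factor `(1 - e^{-δ y}) / (δ y)`, the mean of `e^{-y t}` over `t ∈ [0, δ]`. -/
noncomputable def expMean (δ y : ℝ) : ℝ := (1 - Real.exp (-(δ * y))) / (δ * y)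

theorem abs_expMean_le_one {δ y : ℝ} (hδ : 0 < δ) (hy : 0 < y) : |expMean δ y| ≤ 1 := by
  have hpos : 0 < δ * y := mul_pos hδ hy
  have h1 : Real.exp (-(δ * y)) ≤ 1 := Real.exp_le_one_iff.2 (by linarith)
  rw [expMean, abs_of_nonneg (div_nonneg (by linarith) hpos.le), div_le_one hpos]
  linarith [Real.add_one_le_exp (-(δ * y))]

theorem tendsto_expMean {y : ℝ} (hy : 0 < y) :
    Tendsto (fun δ => expMean δ y) (𝓝[>] 0) (𝓝 1) := by
  have h1 : HasDerivAt (fun t : ℝ => -Real.exp (-t)) 1 0 := by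
    convert! ((hasDerivAt_neg (0 : ℝ)).exp).neg using 1
    simp
  have h2 := hasDerivAt_iff_tendsto_slope.1 h1
  have h3 : Tendsto (fun δ : ℝ => δ * y) (𝓝[>] 0) (𝓝[≠] 0) := by
    refine tendsto_nhdsWithin_iff.2 ⟨?_, ?_⟩
    · have : Tendsto (fun δ : ℝ => δ * y) (𝓝 0) (𝓝 (0 * y)) :=
        (continuous_mul_const y).tendsto 0
      rw [zero_mul] at this
      exact this.mono_left nhdsWithin_le_nhds
    · filter_upwards [self_mem_nhdsWithin] with δ hδ
      exact (mul_pos hδ hy).ne'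
  refine (h2.comp h3).congr fun δ => ?_
  simp only [Function.comp_apply, slope_def_field, expMean, neg_zero, Real.exp_zero, sub_zero]
  ring

/-- At s the kernel over s² equals -(e^{-xs}/s)(1 - e^{-δs})/(δs): smoothing only multiplies the
residue by a damping factor, up to sign. -/
theorem residue_rampKernel (hG : MeromorphicNFOn G Set.univ) {x δ : ℝ} (hδ : 0 < δ) {s : ℝ}
    (hs : s ≠ 0) (h1 : G s = 1) (h' : deriv G s ≠ 0) :
    residue (fun z => rampKernel x δ z / z ^ 2 * recipExt G z) s
      = -(expMean δ s * nonLatticeResidue G x s) := by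
  have hs' : (s : ℂ) ≠ 0 := by exact_mod_cast hs
  have hδ' : (δ : ℂ) ≠ 0 := by exact_mod_cast hδ.ne'
  have hm := hG (Set.mem_univ (s : ℂ))
  have h2 : AnalyticAt ℂ (fun z : ℂ => z ^ 2) s := by fun_prop
  rw [nonLatticeResidue_eq hG x hs' h1 h',
    residue_simple_root (φ := fun z => rampKernel x δ z / z ^ 2) hm h1 h'
      (((differentiable_rampKernel x δ).analyticAt _).fun_div h2 (pow_ne_zero 2 hs'))]
  · have e : Complex.exp (-((x + δ : ℝ) * (s : ℂ))) =
        Complex.exp (-(x * s)) * Complex.exp (-(δ * s)) := by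
      rw [← Complex.exp_add]; push_cast; ring_nf
    rw [rampKernel, e, expMean]
    push_cast
    field_simp
    ring
  · filter_upwards [recipExt_eventuallyEq hm.meromorphicAt] with z hz
    rw [hz]

/-- The kernel vanishes at 0, so it is zD with D(0) = -1 and D'(0) = x + δ/2, and the pole is again
double. The term δ/(2μ) comes from averaging y/μ over [x, x + δ]. -/
theorem residue_rampKernel_zero (hX : IsRenewalSequence P X) (hR : 0 < expMomentBound P (X 0))
    (hG : IsMeromorphicExtension P (X 0) G) {x δ : ℝ} (hδ : 0 < δ) :
    residue (fun z => rampKernel x δ z / z ^ 2 * recipExt G z) 0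
      = -((x / (∫ ω, X 0 ω ∂P) + δ / (2 * ∫ ω, X 0 ω ∂P) + (∫ ω, X 0 ω ^ 2 ∂P) /
        (2 * (∫ ω, X 0 ω ∂P) ^ 2) : ℝ) : ℂ) := by
  have hμ := integral_pos_of_not_ae_zero (hX.nonneg 0) (IsMeromorphicExtension.integrable
    (hX.meas 0) (hX.nonneg 0) hR) hX.ne_zero
  have hδ' : (δ : ℂ) ≠ 0 := by exact_mod_cast hδ.ne'
  obtain ⟨D, hD, eD, D0, D1⟩ := exists_eq_add_mul
    ((differentiable_rampKernel x δ).analyticAt 0)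
  have hexp : ∀ (u : ℝ) (z : ℂ), HasDerivAt (fun z : ℂ => Complex.exp (-(u * z)))
      (-u * Complex.exp (-(u * z))) z := fun u z => by
    have := ((hasDerivAt_id z).const_mul (u : ℂ)).neg.cexp
    convert! this using 1
    simp; ring
  have hd1 : deriv (rampKernel x δ) = fun z => (-(x + δ : ℝ) * Complex.exp (-((x + δ : ℝ) * z)) -
      -x * Complex.exp (-(x * z))) / δ :=
    funext fun z => (((hexp (x + δ) z).sub (hexp x z)).div_const (δ : ℂ)).deriv
  have hd2 : deriv (deriv (rampKernel x δ)) 0 = 2 * x + δ := by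
    rw [hd1]
    have h := ((((hexp (x + δ) 0).const_mul (-(x + δ : ℝ) : ℂ)).sub
      ((hexp x 0).const_mul (-x : ℂ))).div_const (δ : ℂ)).deriv
    have h' : deriv (fun z : ℂ => (-(x + δ : ℝ) * Complex.exp (-((x + δ : ℝ) * z)) -
      -x * Complex.exp (-(x * z))) / δ) 0 = _ := h
    rw [h']
    simp only [mul_zero, neg_zero, Complex.exp_zero]
    push_cast
    field_simp
    ring
  have hd0 : deriv (rampKernel x δ) 0 = -1 := by
    rw [hd1]
    simp only [mul_zero, neg_zero, Complex.exp_zero]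
    push_cast
    field_simp
    ring
  rw [hd0] at D0
  rw [hd2] at D1
  have hN0 : rampKernel x δ 0 = 0 := by simp [rampKernel]
  rw [residue_zero hX hR hG hD, D0, D1]
  · have : ((∫ ω, X 0 ω ∂P : ℝ) : ℂ) ≠ 0 := by exact_mod_cast hμ.ne'
    push_cast
    field_simp
    ring
  · refine eventually_nhdsWithin_of_forall fun z hz => ?_
    have hz' : z ≠ 0 := hz
    rw [eD z, hN0]
    field_simp
    simp

/-! ### Non-lattice case: the limits r → ∞ and δ → 0 -/

theorem pos_of_real_roots (hX : IsRenewalSequence P X) (hR : 0 < expMomentBound P (X 0))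
    (hG : IsMeromorphicExtension P (X 0) G) {z : ℕ → ℝ} (hz0 : z 0 = 0)
    (hinj : Function.Injective z) (hz : ∀ w : ℂ, G w = 1 ↔ ∃ j, w = z j) (j : ℕ) :
    0 < z (j + 1) := by
  have := hX.isProbabilityMeasure
  have h1 := hG.re_nonneg_of_eq_one (hX.meas 0) (hX.nonneg 0) hX.ne_zero hR
    ((hz (z (j + 1))).2 ⟨_, rfl⟩)
  rw [Complex.ofReal_re] at h1
  refine h1.lt_of_ne fun h => ?_
  rw [← hz0] at h
  exact absurd (hinj h) (by simp)

theorem finite_real_roots_lt (hX : IsRenewalSequence P X) (hR : 0 < expMomentBound P (X 0))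
    (hG : IsMeromorphicExtension P (X 0) G) {z : ℕ → ℝ} (hz0 : z 0 = 0)
    (hinj : Function.Injective z) (hz : ∀ w : ℂ, G w = 1 ↔ ∃ j, w = z j) (r : ℝ) :
    {j | z (j + 1) < r}.Finite := by
  have := hX.isProbabilityMeasure
  have hfin := hG.finite_roots (hX.meas 0) (hX.nonneg 0) hX.ne_zero hR
    ((isCompact_Icc (a := 0) (b := r)).image Complex.continuous_ofReal)
  have hi : Function.Injective fun j => (z (j + 1) : ℂ) := fun i j h => by
    simpa using hinj (Complex.ofReal_injective h)
  refine (hfin.preimage hi.injOn).subset fun j hj => ⟨⟨z (j + 1), ⟨?_, le_of_lt hj⟩, rfl⟩, ?_⟩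
  · exact (pos_of_real_roots hX hR hG hz0 hinj hz j).le
  · exact (hz _).2 ⟨_, rfl⟩

theorem norm_smoothedRenewal_sub_le (hX : IsRenewalSequence P X)
    (hR : 0 < expMomentBound P (X 0)) (hG : IsMeromorphicExtension P (X 0) G)
    (hA : ∀ R₀ : ℝ, 0 < R₀ → ConditionA G R₀) {x δ : ℝ} (hx : 0 < x) (hδ : 0 < δ) {z : ℕ → ℝ}
    (hz0 : z 0 = 0) (hinj : Function.Injective z) (hz : ∀ w : ℂ, G w = 1 ↔ ∃ j, w = z j)
    (hd : ∀ j, deriv G (z j) ≠ 0) {r : ℝ} (hr1 : 1 ≤ r) (hr : nonLatticeSup G r ≠ ⊤)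
    {J : Finset ℕ} (hJ : ∀ j, j ∈ J ↔ z (j + 1) < r) :
    ‖(smoothedRenewal P X x δ : ℂ) - ((x / (∫ ω, X 0 ω ∂P) + δ / (2 * ∫ ω, X 0 ω ∂P) +
        (∫ ω, X 0 ω ^ 2 ∂P) / (2 * (∫ ω, X 0 ω ∂P) ^ 2) : ℝ) : ℂ) -
        ∑ j ∈ J, expMean δ (z (j + 1)) * nonLatticeResidue G x (z (j + 1))‖
      ≤ (nonLatticeSup G r).toReal / (x * δ) := by
  classical
  have := hX.isProbabilityMeasure
  have hr0 : 0 < r := one_pos.trans_le hr1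
  have hpos := pos_of_real_roots hX hR hG hz0 hinj hz
  obtain ⟨a, ha, hstrip⟩ := exists_strip_bound hX hR hG hA
  obtain ⟨C, T, hC⟩ := hstrip r hr0
  have hra : ∀ θ : ℝ, G (a + θ * Complex.I) ≠ 1 ∧
      ‖recipExt G (a + θ * Complex.I)‖ ≤ (1 - mgf (X 0) P a)⁻¹ := fun θ => by
    have hre : ((a : ℂ) + θ * Complex.I).re < 0 := by simpa using ha
    have hlt := hG.norm_lt_one (hX.meas 0) (hX.nonneg 0) hX.ne_zero hR hre
    have hGa := hG.analyticAt (hX.meas 0) (hX.nonneg 0) (z := a + θ * Complex.I)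
      (IsMeromorphicExtension.lt_of_re_nonpos hR hre.le)
    refine ⟨fun h => by simp [h] at hlt, ?_⟩
    rw [(recipExt_eventuallyEq_nhds hGa).eq_of_nhds, norm_inv]
    have h1 := mgf_neg_lt_one (hX.meas 0) (hX.nonneg 0) hX.ne_zero ha
    refine inv_anti₀ (by linarith) ?_
    have h2 : ‖G (a + θ * Complex.I)‖ ≤ mgf (X 0) P a := by
      rw [hG.eq_of_re_nonpos hR hre.le]
      simpa using norm_complexMGF_le_mgf (X := X 0) (μ := P) (z := a + θ * Complex.I)
    have h3 := norm_sub_norm_le 1 (G (a + θ * Complex.I))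
    rw [norm_one] at h3
    linarith
  have hrr := nonLatticeSup_bound hG.meromorphic hr0 hr
  have hi : Function.Injective fun j => (z (j + 1) : ℂ) := fun i j h => by
    simpa using hinj (Complex.ofReal_injective h)
  have h0 : (0 : ℂ) ∉ J.image fun j => (z (j + 1) : ℂ) := fun h => by
    obtain ⟨j, -, hj⟩ := Finset.mem_image.1 h
    exact (hpos j).ne' (by exact_mod_cast hj)
  have key := integral_vertical_sub hX hR hG hx.le hδ ha hr0 hra hrr hC
    (fun w hw => by obtain ⟨j, rfl⟩ := (hz w).1 hw; simp)
    (S := insert 0 (J.image fun j => (z (j + 1) : ℂ))) (fun w => by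
      simp only [Finset.mem_insert, Finset.mem_image, hJ, hz]
      constructor
      · rintro (rfl | ⟨j, hj, rfl⟩)
        · exact ⟨⟨0, by simp [hz0]⟩, hr0⟩
        · exact ⟨⟨_, rfl⟩, hj⟩
      · rintro ⟨⟨_ | j, rfl⟩, h⟩
        · exact .inl (by simp [hz0])
        · exact .inr ⟨j, h, rfl⟩)
  rw [integral_eq_smoothedRenewal hX hR hG ha, Finset.sum_insert h0,
    Finset.sum_image hi.injOn, residue_rampKernel_zero hX hR hG hδ,
    Finset.sum_congr rfl fun j _ => residue_rampKernel hG.meromorphic hδ (hpos j).ne'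
      ((hz _).2 ⟨_, rfl⟩) (hd _), Finset.sum_neg_distrib] at key
  have hpi : (Real.pi : ℂ) ≠ 0 := by exact_mod_cast Real.pi_ne_zero
  have e := norm_integral_vertical_le hx.le hδ hr1 fun θ => (hrr θ).2
  set I := ∫ θ : ℝ, rampKernel x δ (r + θ * Complex.I) / (r + θ * Complex.I) ^ 2 *
      recipExt G (r + θ * Complex.I) with hI
  have e2 : ∀ A B : ℂ, I - 2 * Real.pi * (smoothedRenewal P X x δ : ℂ)
      = 2 * Real.pi * (-A + -B) → (smoothedRenewal P X x δ : ℂ) - A - B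
        = (2 * (Real.pi : ℂ))⁻¹ * I := fun A B h => by
    field_simp
    linear_combination -h
  rw [e2 _ _ key, norm_mul, norm_inv, norm_mul, Complex.norm_real, Complex.norm_ofNat,
    Real.norm_eq_abs, abs_of_pos Real.pi_pos]
  -- This absorbs the factor r by which `nonLatticeSup` is normalised; it is where x > 0 enters the
  -- estimate.
  have h1 : r * Real.exp (-(x * r)) ≤ x⁻¹ := by
    rw [Real.exp_neg, ← div_eq_mul_inv, div_le_iff₀ (Real.exp_pos _), inv_mul_eq_div,
      le_div_iff₀ hx]
    linarith [Real.add_one_le_exp (x * r)]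
  calc (2 * Real.pi)⁻¹ * ‖I‖ ≤ (2 * Real.pi)⁻¹ * (2 * Real.exp (-(x * r)) / δ *
        ((nonLatticeSup G r).toReal * r) * Real.pi) := by gcongr
    _ = (nonLatticeSup G r).toReal / δ * (r * Real.exp (-(x * r))) := by
      field_simp
    _ ≤ (nonLatticeSup G r).toReal / δ * x⁻¹ := by gcongr
    _ = _ := by field_simp

/-- Absolute summability gives a sum; its value is read off along the finite sets of roots below
r_n, which exhaust all indices. No ordering of the enumeration is needed. -/
theorem hasSum_smoothedRenewal (hX : IsRenewalSequence P X)
    (hR : 0 < expMomentBound P (X 0)) (hG : IsMeromorphicExtension P (X 0) G)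
    (hA : ∀ R₀ : ℝ, 0 < R₀ → ConditionA G R₀) {x δ : ℝ} (hx : 0 < x) (hδ : 0 < δ) {z : ℕ → ℝ}
    (hz0 : z 0 = 0) (hinj : Function.Injective z) (hz : ∀ w : ℂ, G w = 1 ↔ ∃ j, w = z j)
    (hd : ∀ j, deriv G (z j) ≠ 0)
    (hs : Summable fun j : ℕ => ‖nonLatticeResidue G x (z (j + 1))‖)
    (hσ : liminf (nonLatticeSup G) atTop = 0) :
    HasSum (fun j => expMean δ (z (j + 1)) * nonLatticeResidue G x (z (j + 1)))
      ((smoothedRenewal P X x δ : ℂ) - ((x / (∫ ω, X 0 ω ∂P) + δ / (2 * ∫ ω, X 0 ω ∂P) +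
        (∫ ω, X 0 ω ^ 2 ∂P) / (2 * (∫ ω, X 0 ω ∂P) ^ 2) : ℝ) : ℂ)) := by
  obtain ⟨r, hr, hσr⟩ := exists_seq_of_liminf_eq_zero hσ
  have hpos := pos_of_real_roots hX hR hG hz0 hinj hz
  have hfin := finite_real_roots_lt hX hR hG hz0 hinj hz
  have hsum : Summable fun j => expMean δ (z (j + 1)) * nonLatticeResidue G x (z (j + 1)) := by
    refine Summable.of_norm_bounded hs fun j => ?_
    rw [norm_mul, Complex.norm_real, Real.norm_eq_abs]
    exact mul_le_of_le_one_left (norm_nonneg _) (abs_expMean_le_one hδ (hpos j))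
  have hJ : Tendsto (fun n => (hfin (r n)).toFinset) atTop atTop := by
    refine tendsto_atTop.2 fun t => ?_
    have := (Filter.eventually_all_finset t).2 fun j (_ : j ∈ t) =>
      hr.eventually_gt_atTop (z (j + 1))
    filter_upwards [this] with n hn j hj
    simpa using hn j hj
  have h1 := hsum.hasSum.comp hJ
  have h2 : Tendsto (fun n => ∑ j ∈ (hfin (r n)).toFinset,
      expMean δ (z (j + 1)) * nonLatticeResidue G x (z (j + 1))) atTop
      (𝓝 ((smoothedRenewal P X x δ : ℂ) - ((x / (∫ ω, X 0 ω ∂P) + δ / (2 * ∫ ω, X 0 ω ∂P) +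
        (∫ ω, X 0 ω ^ 2 ∂P) / (2 * (∫ ω, X 0 ω ∂P) ^ 2) : ℝ) : ℂ))) := by
    rw [tendsto_iff_norm_sub_tendsto_zero]
    have h3 : Tendsto (fun n => (nonLatticeSup G (r n)).toReal / (x * δ)) atTop (𝓝 0) := by
      simpa using ((ENNReal.tendsto_toReal ENNReal.zero_ne_top).comp hσr).div_const (x * δ)
    refine squeeze_zero' (Eventually.of_forall fun _ => norm_nonneg _) ?_ h3
    filter_upwards [hr.eventually_ge_atTop 1, hσr.eventually_lt_const ENNReal.zero_lt_top]
      with n hn1 hn2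
    rw [norm_sub_rev]
    exact norm_smoothedRenewal_sub_le hX hR hG hA hx hδ hz0 hinj hz hd hn1 hn2.ne fun j => by simp
  rw [← tendsto_nhds_unique h1 h2]
  exact hsum.hasSum

/-- Since |`expMean`| ≤ 1, the norms of the residues dominate the damped series uniformly in δ, so δ
→ 0 passes through the sum; the other side tends to v(x). -/
theorem hasSum_nonLatticeResidue (hX : IsRenewalSequence P X)
    (hR : 0 < expMomentBound P (X 0)) (hG : IsMeromorphicExtension P (X 0) G)
    (hF : ¬ IsLattice (P.map (X 0))) (hA : ∀ R₀ : ℝ, 0 < R₀ → ConditionA G R₀) {x : ℝ} (hx : 0 < x)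
    {z : ℕ → ℝ} (hz0 : z 0 = 0) (hinj : Function.Injective z)
    (hz : ∀ w : ℂ, G w = 1 ↔ ∃ j, w = z j) (hd : ∀ j, deriv G (z j) ≠ 0)
    (hs : Summable fun j : ℕ => ‖nonLatticeResidue G x (z (j + 1))‖)
    (hσ : liminf (nonLatticeSup G) atTop = 0) :
    HasSum (fun j => nonLatticeResidue G x (z (j + 1))) (remainder P X x : ℂ) := by
  have hpos := pos_of_real_roots hX hR hG hz0 hinj hz
  have h1 : Tendsto (fun δ : ℝ => ∑' j, (expMean δ (z (j + 1)) : ℂ) *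
      nonLatticeResidue G x (z (j + 1))) (𝓝[>] 0)
      (𝓝 (∑' j, nonLatticeResidue G x (z (j + 1)))) := by
    refine tendsto_tsum_of_dominated_convergence hs (fun j => ?_) ?_
    · simpa using ((Complex.continuous_ofReal.tendsto 1).comp
        (tendsto_expMean (hpos j))).mul_const (nonLatticeResidue G x (z (j + 1)))
    · filter_upwards [self_mem_nhdsWithin] with δ hδ j
      rw [norm_mul, Complex.norm_real, Real.norm_eq_abs]
      exact mul_le_of_le_one_left (norm_nonneg _) (abs_expMean_le_one hδ (hpos j))
  have h2 : Tendsto (fun δ : ℝ => ∑' j, (expMean δ (z (j + 1)) : ℂ) *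
      nonLatticeResidue G x (z (j + 1))) (𝓝[>] 0) (𝓝 (remainder P X x : ℂ)) := by
    have h3 : Tendsto (fun δ : ℝ => x / (∫ ω, X 0 ω ∂P) + δ / (2 * ∫ ω, X 0 ω ∂P) +
        (∫ ω, X 0 ω ^ 2 ∂P) / (2 * (∫ ω, X 0 ω ∂P) ^ 2)) (𝓝[>] 0)
        (𝓝 (x / (∫ ω, X 0 ω ∂P) + 0 / (2 * ∫ ω, X 0 ω ∂P) +
        (∫ ω, X 0 ω ^ 2 ∂P) / (2 * (∫ ω, X 0 ω ∂P) ^ 2))) :=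
      (Continuous.tendsto (by fun_prop) 0).mono_left nhdsWithin_le_nhds
    have h4 := (Complex.continuous_ofReal.tendsto _).comp ((hX.tendsto_smoothedRenewal x).sub h3)
    have e : remainder P X x = renewalFunction P X x - (x / (∫ ω, X 0 ω ∂P) +
        0 / (2 * ∫ ω, X 0 ω ∂P) + (∫ ω, X 0 ω ^ 2 ∂P) / (2 * (∫ ω, X 0 ω ∂P) ^ 2)) := by
      rw [remainder, if_neg hF]
      ring
    rw [e]
    refine h4.congr' ?_
    filter_upwards [self_mem_nhdsWithin] with δ hδ
    rw [(hasSum_smoothedRenewal hX hR hG hA hx hδ hz0 hinj hz hd hs hσ).tsum_eq]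
    simp only [Function.comp_apply, Complex.ofReal_sub]
  rw [← tendsto_nhds_unique h1 h2]
  exact hs.of_norm.hasSum

end

end Renewal

/-! ### The main theorem -/

theorem mainTheorem5 {Ω : Type*} [MeasurableSpace Ω] (P : Measure Ω) [IsProbabilityMeasure P]
    (X : ℕ → Ω → ℝ) (hX_meas : ∀ i, AEMeasurable (X i) P) (hX_nonneg : ∀ i, ∀ᵐ ω ∂P, 0 ≤ X i ω)
    (hX_indep : iIndepFun X P) (hX_ident : ∀ i, IdentDistrib (X i) (X 0) P P)
    (hR : 0 < Renewal.expMomentBound P (X 0))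
    (G : ℂ → ℂ) (hG : Renewal.IsMeromorphicExtension P (X 0) G) :
    -- the lattice case
    (Renewal.HasMesh (P.map (X 0)) 1 →
      liminf (Renewal.latticeSup G) atTop = 0 →
      -- finitely many roots in each left half of the fundamental domain
      (∀ r : ℝ, {z ∈ Renewal.latticeRoots G | z.re < r}.Finite) ∧
      (∃ r : ℕ → ℝ, Tendsto r atTop atTop ∧
        Tendsto (fun n => Renewal.latticeSup G (r n)) atTop (𝓝 0)) ∧
      ∀ k : ℕ, Renewal.expectedCount P X k < ⊤ ∧
        -- finitely many roots
        ((Renewal.latticeRoots G).Finite →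
          (Renewal.remainder P X k : ℂ)
            = ∑ᶠ z ∈ Renewal.latticeRoots G \ {0}, Renewal.latticeResidue G k z) ∧
        -- summation along real parts
        (∀ r : ℕ → ℝ, Tendsto r atTop atTop →
          Tendsto (fun n => Renewal.latticeSup G (r n)) atTop (𝓝 0) →
          Tendsto
            (fun n => ∑ᶠ z ∈ {z ∈ Renewal.latticeRoots G \ {0} | z.re < r n},
              Renewal.latticeResidue G k z)
            atTop (𝓝 (Renewal.remainder P X k : ℂ))) ∧
        -- infinitely many roots, ordered by real part, with convergent series
        (∀ z : ℕ → ℂ, z 0 = 0 → Function.Injective z → Set.range z = Renewal.latticeRoots G →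
          Monotone (fun j => (z j).re) →
          ∀ s : ℂ, Tendsto
            (fun n => ∑ j ∈ Finset.Icc 1 n, Renewal.latticeResidue G k (z j)) atTop (𝓝 s) →
          (Renewal.remainder P X k : ℂ) = s)) ∧
    -- the non-lattice case
    (¬ Renewal.IsLattice (P.map (X 0)) →
      (∀ R₀ : ℝ, 0 < R₀ → Renewal.ConditionA G R₀) →
      ∀ x : ℝ, 0 < x →
      ∀ z : ℕ → ℝ, z 0 = 0 → Function.Injective z →
      (∀ w : ℂ, G w = 1 ↔ ∃ j, w = z j) →
      (∀ j, deriv G (z j) ≠ 0) →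
      Summable (fun j : ℕ => ‖Renewal.nonLatticeResidue G x (z (j + 1))‖) →
      liminf (Renewal.nonLatticeSup G) atTop = 0 →
      Renewal.expectedCount P X x < ⊤ ∧
      (∀ j : ℕ, 1 ≤ j → Renewal.nonLatticeResidue G x (z j)
        = -(Complex.exp (-(x * z j)) / (z j * deriv G (z j)))) ∧
      HasSum (fun j : ℕ => Renewal.nonLatticeResidue G x (z (j + 1)))
        (Renewal.remainder P X x : ℂ)) := by
  -- Non-degeneracy is not a hypothesis; each case supplies it, because the zero variable is lattice
  -- and has no mesh.
  have hX : ¬ X 0 =ᵐ[P] 0 → Renewal.IsRenewalSequence P X := fun h =>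
    ⟨hX_meas, hX_nonneg, hX_indep, hX_ident, h⟩
  refine ⟨fun hF hσ => ?_, fun hF hA x hx z hz0 hinj hz hd hs hσ => ?_⟩
  · have hX := hX (Renewal.not_ae_zero_of_hasMesh (hX_meas 0) hF)
    obtain ⟨r, hr, hσr⟩ := Renewal.exists_seq_of_liminf_eq_zero hσ
    refine ⟨Renewal.finite_latticeRoots hX hR hG, ⟨r, hr, hσr⟩, fun k =>
      ⟨hX.expectedCount_lt_top k, Renewal.remainder_eq_finsum hX hR hG hF k hr hσr,
        fun r hr hσr => Renewal.tendsto_sum_latticeResidue hX hR hG hF k hr hσr,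
        fun z hz0 hinj hrange hmono s hs =>
          Renewal.remainder_eq_of_tendsto hX hR hG hF k hr hσr hz0 hinj hrange hmono hs⟩⟩
  · have hX := hX (Renewal.not_ae_zero_of_not_isLattice (hX_meas 0) hF)
    refine ⟨hX.expectedCount_lt_top x, fun j hj => ?_,
      Renewal.hasSum_nonLatticeResidue hX hR hG hF hA hx hz0 hinj hz hd hs hσ⟩
    refine Renewal.nonLatticeResidue_eq hG.meromorphic x (fun h => ?_) ((hz _).2 ⟨j, rfl⟩) (hd j)
    rw [Complex.ofReal_eq_zero, ← hz0] at h
    have := hinj h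
    omega
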